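/- Notation. Fix $n,m\in\mathbb N$ and independent distributions: $\mathcal S$ over $n$-qubit states (unit vectors of $\mathbb C^{2^n}$), given to Alice, and $\mathcal U$ over the unitary group $U(2^n)$ (Borel probability measures), giving Bob's input. An $m$-bit classical protocol is a randomized one-way protocol: Alice, given $|\psi\rangle\sim\mathcal S$, sends a message $x\in\{0,1\}^m$ to Bob, who, given $x$ and $U\sim\mathcal U$, outputs $z\in\{0,1\}^n$; Alice and Bob may use (shared or private) randomness independent of the inputs, and all maps are measurable. The protocol solves $\varepsilon$-DXHOG with respect to $\mathcal S$ and $\mathcal U$ if $\mathbb E\big[|\langle z|U|\psi\rangle|^2\big]\ge \frac{1+\varepsilon}{2^n}$, the expectation being over $|\psi\rangle$, $U$ and the randomness of the protocol. For $g:U(2^n)\to\{0,1\}^n$ put \[ M(g;\mathcal U)=\mathbb E_{U\sim\mathcal U}\big[U^\dagger|g(U)\rangle\langle g(U)|U\big]. \] Theorem. Let $\mathcal S$ be the Haar measure over $n$-qubit states (the law of $U|0^n\rangle$ for Haar-random $U\in U(2^n)$), and let $\mathcal U$ be a distribution over $U(2^n)$ such that for every (measurable) $g:U(2^n)\to\{0,1\}^n$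 \[ \|M(g;\mathcal U)\|_F\le A\quad\text{and}\quad\|M(g;\mathcal U)\|_{op}\le B. \] Let $\varepsilon\in\mathbb R$ and suppose that some $m$-bit classical protocol solves $\varepsilon$-DXHOG with respect to $\mathcal S$ and $\mathcal U$. Then: (i) For every $a>1$, with $\gamma=\frac{ae^{1/a}}{a+1}+\frac{2}{e(a^3-a)}-1$ and \[ t^*=\begin{cases}\sqrt{\ln(2)\,m\cdot4\gamma a^2A^2}& \text{if } m\le\frac{\gamma A^2}{\ln(2)B^2},\\ aB\big(\ln(2)m+\gamma A^2/B^2\big)& \text{if } m>\frac{\gamma A^2}{\ln(2)B^2},\end{cases} \] one has \[ \varepsilon\le\begin{cases} t^*+2^m\sqrt{\pi\gamma}\,aA\Big(\operatorname{erf}\big(\tfrac{\sqrt\gamma A}{B}\big)-\operatorname{erf}\big(\tfrac{t^*}{2\sqrt\gamma aA}\big)\Big)+2^m aB\exp\big(-\tfrac{\gamma A^2}{B^2}\big)& \text{if } m\le\frac{\gamma A^2}{\ln(2)B^2},\\ t^*+aB& \text{if } m>\frac{\gamma A^2}{\ln(2)B^2},\end{cases} \] where $\operatorname{erf}(x)=\frac{2}{\sqrt\pi}\int_0^x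 e^{-t^2}\,dt$. (ii) $\varepsilon\le C\max\{\sqrt m\,A,\;mB\}$ for a universal constant $C>0$ (independent of $n,m,\mathcal U,A,B,\varepsilon$ and the protocol). (iii) $m\ge c\,\min\{\varepsilon^2/A^2,\;\varepsilon/B\}$ for a universal constant $c>0$ (independent of the same data). -/

import Mathlib

open MeasureTheory Matrix

universe u

noncomputable section

namespace DXHOG

/-- Bit strings of length `n`. -/
abbrev Bits (n : ℕ) : Type := Fin n → Bool

/-- The unitary group `U(2^n)`, rows and columns indexed by `n`-bit strings. -/
abbrev UGroup (n : ℕ) : Type := Matrix.unitaryGroup (Bits n) ℂ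

/-- The Borel sigma-algebra on `U(2^n)`. -/
instance instMeasurableSpaceUGroup (n : ℕ) : MeasurableSpace (UGroup n) := borel _

instance instBorelSpaceUGroup (n : ℕ) : BorelSpace (UGroup n) := ⟨rfl⟩

/-- `n`-qubit (pure) states: unit vectors of `ℂ^(2^n)`. -/
abbrev QState (n : ℕ) : Type := Metric.sphere (0 : EuclideanSpace ℂ (Bits n)) 1

/-- The computational basis state `|x⟩`. -/
def ket {n : ℕ} (x : Bits n) : QState n :=
  ⟨EuclideanSpace.single x 1, by simp⟩

/-- The state `U|ψ⟩`. -/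
def applyU {n : ℕ} (U : UGroup n) (ψ : QState n) : QState n :=
  ⟨WithLp.toLp 2 ((U : Matrix (Bits n) (Bits n) ℂ) *ᵥ (ψ : EuclideanSpace ℂ (Bits n)).ofLp), by
    have h := ψ.2
    rw [mem_sphere_zero_iff_norm] at h ⊢
    have key : ‖WithLp.toLp 2 ((U : Matrix (Bits n) (Bits n) ℂ) *ᵥ
        (ψ : EuclideanSpace ℂ (Bits n)).ofLp)‖ ^ 2 =
        ‖(ψ : EuclideanSpace ℂ (Bits n))‖ ^ 2 := by
      have hU : (U : Matrix (Bits n) (Bits n) ℂ)ᴴ * (U : Matrix (Bits n) (Bits n) ℂ) = 1 :=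
        (Matrix.mem_unitaryGroup_iff'.1 U.2)
      have h2 : ∀ v : Bits n → ℂ,
          ((‖(WithLp.toLp 2 v : EuclideanSpace ℂ (Bits n))‖ ^ 2 : ℝ) : ℂ) = star v ⬝ᵥ v := by
        intro v
        rw [EuclideanSpace.norm_sq_eq]
        simp only [dotProduct, Pi.star_apply, RCLike.star_def]
        push_cast
        exact Finset.sum_congr rfl fun i _ => (Complex.conj_mul' (v i)).symm
      have h3 := h2 ((U : Matrix (Bits n) (Bits n) ℂ) *ᵥ (ψ : EuclideanSpace ℂ (Bits n)).ofLp)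
      rw [Matrix.star_mulVec, ← Matrix.dotProduct_mulVec, Matrix.mulVec_mulVec, hU,
        Matrix.one_mulVec, ← h2] at h3
      exact_mod_cast h3
    rw [h] at key
    have := norm_nonneg (WithLp.toLp 2 ((U : Matrix (Bits n) (Bits n) ℂ) *ᵥ
        (ψ : EuclideanSpace ℂ (Bits n)).ofLp))
    nlinarith⟩

lemma continuous_applyU {n : ℕ} :
    Continuous fun p : UGroup n × QState n => applyU p.1 p.2 := by
  unfold applyU
  refine Continuous.subtype_mk ?_ _
  refine (PiLp.continuous_toLp 2 _).comp ?_
  exact (continuous_subtype_val.comp continuous_fst).matrix_mulVec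
    ((PiLp.continuous_ofLp 2 _).comp (continuous_subtype_val.comp continuous_snd))

instance instCompactSpaceUGroup (n : ℕ) : CompactSpace (UGroup n) := by
  refine isCompact_iff_compactSpace.1 ?_
  have hc : IsCompact (Set.univ.pi fun _ : Bits n => Set.univ.pi fun _ : Bits n =>
      Metric.closedBall (0 : ℂ) 1) :=
    isCompact_univ_pi fun _ => isCompact_univ_pi fun _ => isCompact_closedBall 0 1
  refine IsCompact.of_isClosed_subset (X := Matrix (Bits n) (Bits n) ℂ) hc ?_ ?_
  · have : (Matrix.unitaryGroup (Bits n) ℂ : Set (Matrix (Bits n) (Bits n) ℂ)) =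
        {M | M * star M = 1} := by
      ext M
      exact Matrix.mem_unitaryGroup_iff
    rw [this]
    exact isClosed_eq (continuous_id.matrix_mul continuous_star) continuous_const
  · intro M hM i _ j _
    simpa using entry_norm_bound_of_unitary hM i j

/-- The Haar probability measure on `U(2^n)`. -/
def haarUnitary (n : ℕ) : Measure (UGroup n) :=
  Measure.haarMeasure (⊤ : TopologicalSpace.PositiveCompacts (UGroup n))

instance instProbHaarUnitary (n : ℕ) : IsProbabilityMeasure (haarUnitary n) :=
  ⟨Measure.haarMeasure_self (K₀ := (⊤ : TopologicalSpace.PositiveCompacts (UGroup n)))⟩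

/-- The Haar measure over `n`-qubit states: the law of `U|0^n⟩` for a Haar-random `U`. -/
def haarState (n : ℕ) : Measure (QState n) :=
  (haarUnitary n).map fun U => applyU U (ket fun _ => false)

instance instProbHaarState (n : ℕ) : IsProbabilityMeasure (haarState n) :=
  Measure.isProbabilityMeasure_map
    (continuous_applyU.comp (continuous_id.prodMk continuous_const)).measurable.aemeasurable

/-- The matrix `M(g; 𝒰) = 𝔼_{U ∼ 𝒰} [U† |g(U)⟩⟨g(U)| U]` (entrywise expectation). -/
def M {n : ℕ} (𝒰 : Measure (UGroup n)) (g : UGroup n → Bits n) :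
    Matrix (Bits n) (Bits n) ℂ :=
  Matrix.of fun i j => ∫ U : UGroup n,
    ((U : Matrix (Bits n) (Bits n) ℂ)ᴴ * Matrix.single (g U) (g U) (1 : ℂ) *
      (U : Matrix (Bits n) (Bits n) ℂ)) i j ∂𝒰

/-- The Frobenius norm `√Tr(X†X)`. -/
def frobNorm {ι : Type} [Fintype ι] (X : Matrix ι ι ℂ) : ℝ :=
  Real.sqrt (Matrix.trace (Xᴴ * X)).re

/-- The operator norm with respect to the Euclidean norm. -/
def opNorm {ι : Type} [Fintype ι] [DecidableEq ι] (X : Matrix ι ι ℂ) : ℝ :=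
  ‖Matrix.toEuclideanCLM (n := ι) (𝕜 := ℂ) X‖

/-- Every strategy `g : U(2^n) → {0,1}^n` of Bob has `‖M(g; 𝒰)‖_F ≤ A` and `‖M(g; 𝒰)‖_op ≤ B`. -/
def NormBounds {n : ℕ} (𝒰 : Measure (UGroup n)) (A B : ℝ) : Prop :=
  ∀ g : UGroup n → Bits n, Measurable g → frobNorm (M 𝒰 g) ≤ A ∧ opNorm (M 𝒰 g) ≤ B

/-- A randomized classical one-way protocol with `m` bits of communication for `n`-qubit inputs.
All the randomness used by Alice and Bob (shared or private) is a point of the probability space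
`(Ω, rand)`, independent of the inputs. A protocol is deterministic when `Ω` is a point. -/
structure ClassicalProtocol (n m : ℕ) (Ω : Type u) [MeasurableSpace Ω] where
  /-- the law of the random seed -/
  rand : Measure Ω
  isProb : IsProbabilityMeasure rand
  /-- Alice's message, from the seed and her state -/
  alice : Ω → QState n → Bits m
  measurable_alice : Measurable fun p : Ω × QState n => alice p.1 p.2
  /-- Bob's output, from the message, the seed and his unitary -/
  bob : Bits m → Ω → UGroup n → Bits n
  measurable_bob : ∀ x, Measurable fun p : Ω × UGroup n => bob x p.1 p.2

/-- The output `z` of the protocol. -/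
def ClassicalProtocol.output {n m : ℕ} {Ω : Type u} [MeasurableSpace Ω]
    (P : ClassicalProtocol n m Ω) (ω : Ω) (ψ : QState n) (U : UGroup n) : Bits n :=
  P.bob (P.alice ω ψ) ω U

/-- The expectation of `|⟨z|U|ψ⟩|²` over the seed, `ψ ∼ 𝒮` and `U ∼ 𝒰`, all independent. -/
def ClassicalProtocol.score {n m : ℕ} {Ω : Type u} [MeasurableSpace Ω]
    (P : ClassicalProtocol n m Ω) (𝒮 : Measure (QState n)) (𝒰 : Measure (UGroup n)) : ℝ :=
  ∫ p : Ω × QState n × UGroup n,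
    ‖(applyU p.2.2 p.2.1 : EuclideanSpace ℂ (Bits n)) (P.output p.1 p.2.1 p.2.2)‖ ^ 2
      ∂(P.rand.prod (𝒮.prod 𝒰))

/-- The protocol solves `ε`-DXHOG with respect to `𝒮` and `𝒰`. -/
def ClassicalProtocol.Solves {n m : ℕ} {Ω : Type u} [MeasurableSpace Ω]
    (P : ClassicalProtocol n m Ω) (𝒮 : Measure (QState n)) (𝒰 : Measure (UGroup n))
    (ε : ℝ) : Prop :=
  (1 + ε) / 2 ^ n ≤ P.score 𝒮 𝒰

/-- The error function on the reals. -/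
def erf (x : ℝ) : ℝ := 2 / Real.sqrt Real.pi * ∫ t in (0 : ℝ)..x, Real.exp (-t ^ 2)

/-- `γ(a) = a e^{1/a} / (a + 1) + 2 / (e (a³ - a)) - 1`. -/
def gam (a : ℝ) : ℝ :=
  a * Real.exp (1 / a) / (a + 1) + 2 / (Real.exp 1 * (a ^ 3 - a)) - 1

/-- The threshold `t*`. -/
def tStar (a A B : ℝ) (m : ℕ) : ℝ :=
  if (m : ℝ) ≤ gam a * A ^ 2 / (Real.log 2 * B ^ 2) then
    Real.sqrt (Real.log 2 * m * (4 * gam a * a ^ 2 * A ^ 2))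
  else
    a * B * (Real.log 2 * m + gam a * A ^ 2 / B ^ 2)

/-- The explicit bound `ε(m, a)` for the norm bounds `A`, `B`. -/
def epsBound (a A B : ℝ) (m : ℕ) : ℝ :=
  if (m : ℝ) ≤ gam a * A ^ 2 / (Real.log 2 * B ^ 2) then
    tStar a A B m
      + 2 ^ m * Real.sqrt (Real.pi * gam a) * a * A *
          (erf (Real.sqrt (gam a) * A / B) - erf (tStar a A B m / (2 * Real.sqrt (gam a) * a * A)))
      + 2 ^ m * a * B * Real.exp (-(gam a * A ^ 2 / B ^ 2))
  else
    tStar a A B m + a * B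

end DXHOG

end

/-!
Fix the random seed and Alice's message `x`: Bob's strategy is then a map `g_x : U(d) → {0,1}^n`, with
`d = 2^n`, and the mean score on a state `ψ` is `⟨ψ|M(g_x)|ψ⟩`. Each `M(g_x)` is a density matrix,
so the Haar average of `X_x = d ⟨ψ|M(g_x)|ψ⟩ - 1` is zero, and all that Alice can do is choose, as
a function of `ψ`, one of the `2^m` variables `X_x`. The theorem is thus a maximal inequality
(`le_of_forall_integral_le`), and it rests on a bound for the moment generating function of `X_x`.

*Moment generating function.* For a Hermitian `X` with eigenvalues `μ_i`, the Gaussian integral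
`∫ e^{λ⟨v|X|v⟩ - |v|²} dv` over `ℂ^d` is `π^d / ∏ (1 - λ μ_i)`. Averaging the same integral over
all unitary rotations of the integrand, and using that the unitary group acts transitively on
spheres and that Haar measure is right invariant, it is also `𝔼_ψ π^d (1 - λ⟨ψ|X|ψ⟩)^{-d}`, which
is at least `π^d 𝔼_ψ e^{λ d ⟨ψ|X|ψ⟩}`. Hence `𝔼_ψ e^{λ d ⟨ψ|X|ψ⟩} ≤ ∏ (1 - λ μ_i)⁻¹`
(`lintegral_exp_quadForm_haarState_le`).

*The constant `γ`.* For `0 ≤ u ≤ 1/a` the power series of the logarithm gives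
`-log(1 - u) - u ≤ (a u)² (-log(1 - 1/a) - 1/a)`, and `-log(1 - 1/a) - 1/a ≤ γ(a)`. Since
`∑ μ_i = 1`, `∑ μ_i² ≤ A²` and `μ_i ≤ B`, it follows that `𝔼 e^{λ X_x} ≤ e^{γ a² A² λ²}` for
`0 ≤ λ ≤ 1/(aB)` (`integral_exp_quadForm_haarState_le`).

*Conclusion.* The selected variable has moment generating function at most `2^m e^{γ a² A² λ²}`.
The explicit bound is the integral of the resulting Chernoff tail beyond `t*`: Gaussian up to
`2 γ a A² / B`, exponential afterwards (`integral_le_epsBound`). The asymptotic bound follows from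
Jensen's inequality for `a = 2` and one choice of `λ` (`integral_le_const_mul_max`), and the lower
bound on `m` by solving it for `m`.
-/

noncomputable section

namespace DXHOG

/-! ### The constant `γ` -/

/-- Termwise comparison of the power series of `-log (1 - x) - x`, which starts at `x²`. -/
lemma neg_log_one_sub_sub_le_scaled {u s : ℝ} (hu : 0 ≤ u) (hus : u ≤ s) (hs : 0 < s)
    (hs1 : s < 1) :
    -Real.log (1 - u) - u ≤ (u / s) ^ 2 * (-Real.log (1 - s) - s) := by
  have key : ∀ x : ℝ, 0 ≤ x → x < 1 →
      HasSum (fun k : ℕ => x ^ (k + 2) / (k + 2)) (-Real.log (1 - x) - x) := by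
    intro x hx hx1
    have h := Real.hasSum_pow_div_log_of_abs_lt_one (abs_lt.2 ⟨by linarith, hx1⟩)
    rw [← hasSum_nat_add_iff' 1] at h
    have e1 : (fun k : ℕ => x ^ (k + 2) / ((k : ℝ) + 2)) =
        fun k : ℕ => x ^ (k + 1 + 1) / (((k + 1 : ℕ) : ℝ) + 1) := by
      ext k
      push_cast
      ring
    rw [e1]
    simpa using h
  refine hasSum_le (fun k => ?_) (key u hu (by linarith)) ((key s hs.le hs1).mul_left _)
  have h1 : u ^ k ≤ s ^ k := pow_le_pow_left₀ hu hus k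
  have h2 : (u / s) ^ 2 * (s ^ (k + 2) / (k + 2)) = u ^ 2 * s ^ k / (k + 2) := by
    field_simp
    ring
  rw [h2, pow_add, mul_comm (u ^ k)]
  gcongr

/-- Both sides vanish at `s = 0`, and the derivative of the difference is `s` times a quantity
that is nonnegative because `1 + s + s² / 2 ≤ eˢ` and `e < 2.72`. -/
lemma neg_log_one_sub_sub_le_exp {s : ℝ} (hs : 0 ≤ s) (hs1 : s < 1) :
    -Real.log (1 - s) - s ≤
      Real.exp s / (1 + s) + 2 / Real.exp 1 * (s ^ 3 / (1 - s ^ 2)) - 1 := by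
  set F : ℝ → ℝ := fun s => Real.exp s / (1 + s) + 2 / Real.exp 1 * (s ^ 3 / (1 - s ^ 2)) - 1
    - (-Real.log (1 - s) - s) with hF
  have hder : ∀ x ∈ Set.Ico (0 : ℝ) 1, HasDerivAt F
      ((Real.exp x * (1 + x) - Real.exp x * 1) / (1 + x) ^ 2
        + 2 / Real.exp 1 * ((3 * x ^ 2 * (1 - x ^ 2) - x ^ 3 * (-(2 * x))) / (1 - x ^ 2) ^ 2)
        - (-((-1) / (1 - x)) - 1)) x := by
    rintro x ⟨hx0, hx1⟩
    have h1 : (1 + x) ≠ 0 := by linarith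
    have h2 : (1 - x ^ 2) ≠ 0 := by nlinarith
    have h3 : (1 - x) ≠ 0 := by linarith
    have d1 : HasDerivAt (fun x : ℝ => 1 + x) 1 x := (hasDerivAt_id x).const_add 1
    have d2 : HasDerivAt (fun x : ℝ => 1 - x) (-1) x := (hasDerivAt_id x).const_sub 1
    have d3 : HasDerivAt (fun x : ℝ => x ^ 3) (3 * x ^ 2) x := by simpa using hasDerivAt_pow 3 x
    have d4 : HasDerivAt (fun x : ℝ => 1 - x ^ 2) (-(2 * x)) x := by
      simpa using (hasDerivAt_pow 2 x).const_sub 1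
    exact ((((Real.hasDerivAt_exp x).div d1 h1).add ((d3.div d4 h2).const_mul _)).sub_const 1).sub
      ((d2.log h3).neg.sub (hasDerivAt_id x))
  have hmono : MonotoneOn F (Set.Ico 0 1) := by
    refine monotoneOn_of_deriv_nonneg (convex_Ico 0 1)
      (fun x hx => (hder x hx).continuousAt.continuousWithinAt)
      (fun x hx => (hder x (interior_subset hx)).differentiableAt.differentiableWithinAt) ?_
    intro x hx
    have hx' := interior_subset hx
    rw [(hder x hx').deriv]
    obtain ⟨hx0, hx1⟩ := hx'
    have h3 : 0 < 1 - x := by linarith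
    have h1 : 0 < 1 + x := by linarith
    have h2 : 1 - x ^ 2 = (1 - x) * (1 + x) := by ring
    have he : (0.735 : ℝ) ≤ 2 / Real.exp 1 := by
      rw [le_div_iff₀ (Real.exp_pos 1)]
      have := Real.exp_one_lt_d9
      linarith
    have hex := Real.quadratic_le_exp_of_nonneg hx0
    have hx3 : 0 ≤ 3 * x - x ^ 3 := by nlinarith [mul_nonneg hx0 h3.le]
    have main : (1 - x) * (1 + x) ^ 2 ≤
        Real.exp x * (1 - x) ^ 2 + 2 / Real.exp 1 * (3 * x - x ^ 3) := by
      have e1 := mul_le_mul_of_nonneg_right hex (sq_nonneg (1 - x))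
      have e2 := mul_le_mul_of_nonneg_right he hx3
      nlinarith [pow_nonneg hx0 2, pow_nonneg hx0 3, pow_nonneg hx0 4]
    have : (Real.exp x * (1 + x) - Real.exp x * 1) / (1 + x) ^ 2
        + 2 / Real.exp 1 * ((3 * x ^ 2 * (1 - x ^ 2) - x ^ 3 * (-(2 * x))) / (1 - x ^ 2) ^ 2)
        - (-((-1) / (1 - x)) - 1)
        = x * (Real.exp x * (1 - x) ^ 2 + 2 / Real.exp 1 * (3 * x - x ^ 3)
            - (1 - x) * (1 + x) ^ 2) / ((1 - x) * (1 + x)) ^ 2 := by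
      rw [h2]
      field_simp
      ring
    rw [this]
    exact div_nonneg (mul_nonneg hx0 (by linarith)) (sq_nonneg _)
  have h0 : F 0 = 0 := by simp [hF]
  have := hmono (Set.left_mem_Ico.2 one_pos) ⟨hs, hs1⟩ hs
  rw [h0] at this
  simp only [hF] at this
  linarith

lemma neg_log_one_sub_sub_le_gam {a : ℝ} (ha : 1 < a) :
    -Real.log (1 - 1 / a) - 1 / a ≤ gam a := by
  have h0 : 0 < a := by linarith
  refine (neg_log_one_sub_sub_le_exp (by positivity) ((div_lt_one h0).2 ha)).trans_eq ?_
  have h2 : a ^ 2 - 1 ≠ 0 := by nlinarith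
  have h3 : a ^ 3 - a ≠ 0 := by
    have : a ^ 3 - a = a * (a ^ 2 - 1) := by ring
    rw [this]; exact mul_ne_zero h0.ne' h2
  have e1 : Real.exp (1 / a) / (1 + 1 / a) = a * Real.exp (1 / a) / (a + 1) := by
    field_simp
  have e2 : (1 / a) ^ 3 / (1 - (1 / a) ^ 2) = 1 / (a ^ 3 - a) := by
    have h4 : 1 - (1 / a) ^ 2 ≠ 0 := by
      have : 1 - (1 / a) ^ 2 = (a ^ 2 - 1) / a ^ 2 := by field_simp
      rw [this]; positivity
    rw [div_eq_div_iff h4 h3]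
    field_simp
  rw [gam, e1, e2]
  field_simp

lemma gam_pos {a : ℝ} (ha : 1 < a) : 0 < gam a := by
  have h0 : 0 < a := by linarith
  refine lt_of_lt_of_le ?_ (neg_log_one_sub_sub_le_gam ha)
  have h1 : 1 / a < 1 := (div_lt_one h0).2 ha
  have h2 : 0 < 1 / a := by positivity
  have := Real.log_lt_sub_one_of_pos (sub_pos.2 h1) (by linarith)
  linarith

/-- The one-variable estimate behind the moment generating function bound: for `u = λ μ` with
`u ≤ 1 / a`, the centred exponential factor `e^{-u} / (1 - u)` is at most `e^{γ a² u²}`. -/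
lemma inv_one_sub_le_exp_gam {a u : ℝ} (ha : 1 < a) (hu : 0 ≤ u) (hua : u ≤ 1 / a) :
    (1 - u)⁻¹ ≤ Real.exp (u + gam a * a ^ 2 * u ^ 2) := by
  have h0 : 0 < a := by linarith
  have h1 : 1 / a < 1 := (div_lt_one h0).2 ha
  have h2 : 0 < 1 / a := by positivity
  have h3 : 0 < 1 - u := by linarith
  have h := neg_log_one_sub_sub_le_scaled hu hua h2 h1
  have h' := mul_le_mul_of_nonneg_left (neg_log_one_sub_sub_le_gam ha) (sq_nonneg (u / (1 / a)))
  rw [← Real.log_le_iff_le_exp (inv_pos.2 h3), Real.log_inv]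
  have : (u / (1 / a)) ^ 2 * gam a = gam a * a ^ 2 * u ^ 2 := by
    field_simp
  linarith

/-! ### Tail bounds from moment generating functions -/

section Tail

variable {S : Type*} [MeasurableSpace S] {μ : Measure S} [IsProbabilityMeasure μ]
  {Z : S → ℝ} {K N k L : ℝ}

lemma integrable_of_abs_le (hZ : Measurable Z) (hK : ∀ s, |Z s| ≤ K) : Integrable Z μ :=
  Integrable.of_bound hZ.aestronglyMeasurable K (Filter.Eventually.of_forall hK)

lemma integrable_exp_mul_of_abs_le (hZ : Measurable Z) (hK : ∀ s, |Z s| ≤ K) (l : ℝ) :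
    Integrable (fun s => Real.exp (l * Z s)) μ := by
  refine integrable_of_abs_le (K := Real.exp (|l| * K)) (by fun_prop) fun s => ?_
  rw [Real.abs_exp]
  refine Real.exp_le_exp.2 ((le_abs_self _).trans ?_)
  rw [abs_mul]
  exact mul_le_mul_of_nonneg_left (hK s) (abs_nonneg _)

/-- Jensen's inequality for the exponential, in the form used to bound a mean by a moment
generating function. -/
lemma mul_integral_le_of_integral_exp_le (hZ : Measurable Z) (hK : ∀ s, |Z s| ≤ K) {l c : ℝ}
    (h : ∫ s, Real.exp (l * Z s) ∂μ ≤ Real.exp c) : l * ∫ s, Z s ∂μ ≤ c := by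
  have hJ := convexOn_exp.map_integral_le (μ := μ) (f := fun s => l * Z s)
    Real.continuous_exp.continuousOn isClosed_univ (by simp)
    ((integrable_of_abs_le hZ hK).const_mul l) (integrable_exp_mul_of_abs_le hZ hK l)
  rw [integral_const_mul] at hJ
  exact Real.exp_le_exp.1 (hJ.trans h)

lemma measure_ge_le_of_integral_exp_le (hZ : Measurable Z) (hK : ∀ s, |Z s| ≤ K) {l b : ℝ}
    (hl : 0 ≤ l) (h : ∫ s, Real.exp (l * Z s) ∂μ ≤ b) (t : ℝ) :
    μ {s | t ≤ Z s} ≤ ENNReal.ofReal (b * Real.exp (-l * t)) := by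
  have h1 := ProbabilityTheory.measure_ge_le_exp_mul_mgf (μ := μ) (X := Z) t hl
    (integrable_exp_mul_of_abs_le hZ hK l)
  rw [← ENNReal.ofReal_toReal (measure_ne_top μ {s | t ≤ Z s})]
  refine ENNReal.ofReal_le_ofReal (h1.trans ?_)
  rw [mul_comm]
  exact mul_le_mul_of_nonneg_right h (Real.exp_pos _).le

/-- The mean is at most `t₀` plus the integral of the tail beyond `t₀`. -/
lemma ofReal_integral_sub_le_lintegral_tail (hZ : Measurable Z) (hK : ∀ s, |Z s| ≤ K) (t₀ : ℝ) :
    ENNReal.ofReal (∫ s, Z s ∂μ - t₀) ≤ ∫⁻ t in Set.Ioi t₀, μ {s | t ≤ Z s} := by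
  have hi := integrable_of_abs_le (μ := μ) hZ hK
  have hm : Measurable fun s => max (Z s - t₀) 0 := by fun_prop
  have hi' : Integrable (fun s => max (Z s - t₀) 0) μ := (hi.sub (integrable_const t₀)).pos_part
  have hnn : ∀ᵐ s ∂μ, 0 ≤ max (Z s - t₀) 0 := Filter.Eventually.of_forall fun s => le_max_right _ _
  have h1 : ∫ s, Z s ∂μ - t₀ ≤ ∫ s, max (Z s - t₀) 0 ∂μ := by
    have : ∫ s, (Z s - t₀) ∂μ ≤ ∫ s, max (Z s - t₀) 0 ∂μ :=
      integral_mono (hi.sub (integrable_const t₀)) hi' fun s => le_max_left _ _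
    rw [integral_sub hi (integrable_const t₀)] at this
    simpa using this
  refine (ENNReal.ofReal_le_ofReal h1).trans ?_
  rw [ofReal_integral_eq_lintegral_ofReal hi' hnn,
    lintegral_eq_lintegral_meas_le μ hnn hm.aemeasurable]
  have hpre : Set.Ioi (0 : ℝ) = (fun u => t₀ + u) ⁻¹' Set.Ioi t₀ := by
    ext u; simp
  rw [← (measurePreserving_add_left volume t₀).setLIntegral_comp_preimage_emb
    (measurableEmbedding_addLeft t₀) _ (Set.Ioi t₀), ← hpre]
  refine setLIntegral_mono' measurableSet_Ioi fun u hu => measure_mono fun s hs => ?_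
  have hu : 0 < u := hu
  simp only [Set.mem_ofPred_eq, le_max_iff] at hs ⊢
  rcases hs with hs | hs <;> linarith

variable (hZ : Measurable Z) (hK : ∀ s, |Z s| ≤ K) (hN : 0 ≤ N) (hk : 0 < k) (hL : 0 < L)
  (hmgf : ∀ l, 0 < l → l ≤ L → ∫ s, Real.exp (l * Z s) ∂μ ≤ N * Real.exp (k * l ^ 2))

include hZ hK hN hL hmgf in
lemma lintegral_tail_le_exp (t₀ : ℝ) :
    ∫⁻ t in Set.Ioi t₀, μ {s | t ≤ Z s} ≤
      ENNReal.ofReal (N / L * Real.exp (-L * t₀ + k * L ^ 2)) := by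
  have hint : IntegrableOn (fun t => N * Real.exp (k * L ^ 2) * Real.exp (-L * t)) (Set.Ioi t₀) :=
    (integrableOn_exp_mul_Ioi (neg_lt_zero.2 hL) t₀).const_mul _
  calc ∫⁻ t in Set.Ioi t₀, μ {s | t ≤ Z s}
      ≤ ∫⁻ t in Set.Ioi t₀, ENNReal.ofReal (N * Real.exp (k * L ^ 2) * Real.exp (-L * t)) :=
        lintegral_mono fun t => measure_ge_le_of_integral_exp_le hZ hK hL.le (hmgf L hL le_rfl) t
    _ = ENNReal.ofReal (N / L * Real.exp (-L * t₀ + k * L ^ 2)) := by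
        rw [← ofReal_integral_eq_lintegral_ofReal hint
          (Filter.Eventually.of_forall fun t => by positivity), integral_const_mul,
          integral_exp_mul_Ioi (neg_lt_zero.2 hL), Real.exp_add]
        congr 1
        field_simp

include hZ hK hN hL hmgf in
lemma integral_le_add_exp_tail (t₀ : ℝ) :
    ∫ s, Z s ∂μ ≤ t₀ + N / L * Real.exp (-L * t₀ + k * L ^ 2) := by
  have h := (ofReal_integral_sub_le_lintegral_tail (μ := μ) hZ hK t₀).trans
    (lintegral_tail_le_exp hZ hK hN hL hmgf t₀)
  rw [ENNReal.ofReal_le_ofReal_iff (by positivity)] at h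
  linarith

include hZ hK hN hk hL hmgf in
/-- The Chernoff bound optimized over `0 < l ≤ L`: the tail is Gaussian up to `2 k L`, where the
optimal parameter `t / (2 k)` reaches `L`, and exponential beyond. -/
lemma integral_le_add_gaussian_tail {t₀ : ℝ} (h0 : 0 ≤ t₀) (h1 : t₀ ≤ 2 * k * L) :
    ∫ s, Z s ∂μ ≤ t₀ + N * (∫ t in t₀..(2 * k * L), Real.exp (-t ^ 2 / (4 * k)))
      + N / L * Real.exp (-k * L ^ 2) := by
  have hsplit : Set.Ioi t₀ = Set.Ioc t₀ (2 * k * L) ∪ Set.Ioi (2 * k * L) :=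
    (Set.Ioc_union_Ioi_eq_Ioi h1).symm
  have hint : IntegrableOn (fun t => N * Real.exp (-t ^ 2 / (4 * k)))
      (Set.Ioc t₀ (2 * k * L)) := by
    refine (Continuous.integrableOn_Icc ?_).mono_set Set.Ioc_subset_Icc_self
    fun_prop
  have hg : ∫⁻ t in Set.Ioc t₀ (2 * k * L), μ {s | t ≤ Z s} ≤
      ENNReal.ofReal (N * (∫ t in t₀..(2 * k * L), Real.exp (-t ^ 2 / (4 * k)))) := by
    rw [← intervalIntegral.integral_const_mul, intervalIntegral.integral_of_le h1,
      ofReal_integral_eq_lintegral_ofReal hint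
        (Filter.Eventually.of_forall fun t => by positivity)]
    refine setLIntegral_mono' measurableSet_Ioc fun t ht => ?_
    have ht0 : 0 < t := h0.trans_lt ht.1
    have hl : t / (2 * k) ≤ L := by
      rw [div_le_iff₀ (by positivity)]
      linarith [ht.2]
    have hl0 : 0 < t / (2 * k) := by positivity
    refine (measure_ge_le_of_integral_exp_le hZ hK hl0.le (hmgf _ hl0 hl) t).trans_eq ?_
    rw [mul_assoc, ← Real.exp_add]
    congr 3
    field_simp
    ring
  have hE := lintegral_tail_le_exp hZ hK hN hL hmgf (2 * k * L)
  have hnn : 0 ≤ ∫ t in t₀..(2 * k * L), Real.exp (-t ^ 2 / (4 * k)) :=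
    intervalIntegral.integral_nonneg h1 fun t _ => (Real.exp_pos _).le
  have h := ofReal_integral_sub_le_lintegral_tail (μ := μ) hZ hK t₀
  rw [hsplit] at h
  have h' := (h.trans (lintegral_union_le _ _ _)).trans (add_le_add hg hE)
  rw [← ENNReal.ofReal_add (by positivity) (by positivity),
    ENNReal.ofReal_le_ofReal_iff (by positivity)] at h'
  have e : -L * (2 * k * L) + k * L ^ 2 = -k * L ^ 2 := by ring
  rw [e] at h'
  linarith

end Tail

lemma integral_gaussian_eq_erf {k : ℝ} (hk : 0 < k) (p q : ℝ) :
    ∫ t in p..q, Real.exp (-t ^ 2 / (4 * k)) =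
      Real.sqrt (Real.pi * k) * (erf (q / (2 * Real.sqrt k)) - erf (p / (2 * Real.sqrt k))) := by
  have hs : 0 < Real.sqrt k := Real.sqrt_pos.2 hk
  have hs2 : Real.sqrt k ^ 2 = k := Real.sq_sqrt hk.le
  have hp : 0 < Real.sqrt Real.pi := Real.sqrt_pos.2 Real.pi_pos
  have hi : ∀ x y : ℝ, IntervalIntegrable (fun t : ℝ => Real.exp (-t ^ 2)) volume x y := fun x y =>
    Continuous.intervalIntegrable (by fun_prop) x y
  have e1 : ∀ t : ℝ, Real.exp (-t ^ 2 / (4 * k)) =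
      (fun t : ℝ => Real.exp (-t ^ 2)) (t / (2 * Real.sqrt k)) := by
    intro t
    simp only [div_pow, mul_pow, hs2]
    congr 1
    ring
  simp_rw [e1]
  rw [intervalIntegral.integral_comp_div (fun t : ℝ => Real.exp (-t ^ 2)) (by positivity), erf, erf, ← mul_sub,
    intervalIntegral.integral_interval_sub_left (hi _ _) (hi _ _), Real.sqrt_mul Real.pi_pos.le,
    smul_eq_mul]
  field_simp

/-! ### Gaussian integrals and Haar states -/

section LinearAlgebra

variable {ι : Type} [Fintype ι]

/-- The squared Euclidean norm of a vector of complex coordinates. -/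
def sqNorm (v : ι → ℂ) : ℝ := ∑ i, ‖v i‖ ^ 2

/-- The quadratic form `Re ⟨v|X|v⟩` of a matrix. -/
def quadForm (X : Matrix ι ι ℂ) (v : ι → ℂ) : ℝ := (star v ⬝ᵥ X *ᵥ v).re

lemma sqNorm_nonneg (v : ι → ℂ) : 0 ≤ sqNorm v := Finset.sum_nonneg fun _ _ => sq_nonneg _

lemma star_dotProduct_self (v : ι → ℂ) : star v ⬝ᵥ v = (sqNorm v : ℂ) := by
  simp only [dotProduct, Pi.star_apply, RCLike.star_def, sqNorm]
  push_cast
  exact Finset.sum_congr rfl fun i _ => Complex.conj_mul' (v i)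

lemma sqNorm_eq_norm_sq (ψ : EuclideanSpace ℂ ι) : sqNorm ψ.ofLp = ‖ψ‖ ^ 2 :=
  (EuclideanSpace.norm_sq_eq ψ).symm

lemma sqNorm_smul (c : ℝ) (v : ι → ℂ) : sqNorm ((c : ℂ) • v) = c ^ 2 * sqNorm v := by
  simp [sqNorm, mul_pow, Finset.mul_sum]

lemma quadForm_smul (X : Matrix ι ι ℂ) (c : ℝ) (v : ι → ℂ) :
    quadForm X ((c : ℂ) • v) = c ^ 2 * quadForm X v := by
  simp only [quadForm, mulVec_smul, star_smul, smul_dotProduct, dotProduct_smul, smul_eq_mul,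
    RCLike.star_def, Complex.conj_ofReal, Complex.re_ofReal_mul]
  ring

lemma quadForm_mulVec (X W : Matrix ι ι ℂ) (v : ι → ℂ) :
    quadForm X (W *ᵥ v) = quadForm (Wᴴ * X * W) v := by
  simp only [quadForm, star_mulVec, ← dotProduct_mulVec, mulVec_mulVec, Matrix.mul_assoc]

lemma quadForm_diagonal [DecidableEq ι] (d : ι → ℝ) (v : ι → ℂ) :
    quadForm (diagonal fun i => (d i : ℂ)) v = ∑ i, d i * ‖v i‖ ^ 2 := by
  simp only [quadForm, dotProduct, mulVec_diagonal, Pi.star_apply, Complex.re_sum]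
  refine Finset.sum_congr rfl fun i _ => ?_
  have : star (v i) * ((d i : ℂ) * v i) = ((d i * ‖v i‖ ^ 2 : ℝ) : ℂ) := by
    push_cast
    rw [← Complex.conj_mul' (v i), RCLike.star_def]
    ring
  rw [this, Complex.ofReal_re]

lemma continuous_quadForm (X : Matrix ι ι ℂ) : Continuous (quadForm X) := by
  unfold quadForm
  exact Complex.continuous_re.comp (continuous_star.dotProduct (continuous_const.matrix_mulVec
    continuous_id))

lemma continuous_sqNorm : Continuous (sqNorm : (ι → ℂ) → ℝ) := by
  unfold sqNorm
  fun_prop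

variable [DecidableEq ι]

lemma sqNorm_unitary_mulVec (U : Matrix.unitaryGroup ι ℂ) (v : ι → ℂ) :
    sqNorm ((U : Matrix ι ι ℂ) *ᵥ v) = sqNorm v := by
  have hU : (U : Matrix ι ι ℂ)ᴴ * (U : Matrix ι ι ℂ) = 1 := Matrix.mem_unitaryGroup_iff'.1 U.2
  have h : (sqNorm ((U : Matrix ι ι ℂ) *ᵥ v) : ℂ) = sqNorm v := by
    rw [← star_dotProduct_self, ← star_dotProduct_self, star_mulVec, ← dotProduct_mulVec,
      mulVec_mulVec, hU, one_mulVec]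
  exact_mod_cast h

/-- A Hermitian matrix is a sum of squares in the coordinates of an eigenbasis. -/
lemma quadForm_eigenvectorUnitary_mulVec {X : Matrix ι ι ℂ} (hX : X.IsHermitian) (v : ι → ℂ) :
    quadForm X ((hX.eigenvectorUnitary : Matrix ι ι ℂ) *ᵥ v) =
      ∑ i, hX.eigenvalues i * ‖v i‖ ^ 2 := by
  have h := hX.conjStarAlgAut_star_eigenvectorUnitary
  rw [Unitary.conjStarAlgAut_star_apply] at h
  rw [quadForm_mulVec, ← star_eq_conjTranspose, h]
  exact quadForm_diagonal _ _

lemma quadForm_le_of_eigenvalues_le {X : Matrix ι ι ℂ} (hX : X.IsHermitian) {b : ℝ}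
    (hb : ∀ i, hX.eigenvalues i ≤ b) (v : ι → ℂ) : quadForm X v ≤ b * sqNorm v := by
  have hV : (hX.eigenvectorUnitary : Matrix ι ι ℂ) *
      ((hX.eigenvectorUnitary)⁻¹ : Matrix.unitaryGroup ι ℂ) = (1 : Matrix ι ι ℂ) :=
    Matrix.mem_unitaryGroup_iff.1 hX.eigenvectorUnitary.2
  have hv : (hX.eigenvectorUnitary : Matrix ι ι ℂ) *ᵥ
      ((((hX.eigenvectorUnitary)⁻¹ : Matrix.unitaryGroup ι ℂ) : Matrix ι ι ℂ) *ᵥ v) = v := by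
    rw [mulVec_mulVec, hV, one_mulVec]
  rw [← sqNorm_unitary_mulVec (hX.eigenvectorUnitary)⁻¹ v]
  conv_lhs => rw [← hv]
  rw [quadForm_eigenvectorUnitary_mulVec, sqNorm, Finset.mul_sum]
  exact Finset.sum_le_sum fun i _ => mul_le_mul_of_nonneg_right (hb i) (sq_nonneg _)

end LinearAlgebra

section Gaussian

variable {ι : Type} [Fintype ι]

/-- The real determinant of a unitary map is the squared modulus of the complex one. -/
lemma measurePreserving_unitary_mulVec [DecidableEq ι] (U : Matrix.unitaryGroup ι ℂ) :
    MeasurePreserving (fun v : ι → ℂ => (U : Matrix ι ι ℂ) *ᵥ v) := by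
  have hdet : ‖(U : Matrix ι ι ℂ).det‖ = 1 := by
    have h := Matrix.det_of_mem_unitary U.2
    exact CStarRing.norm_of_mem_unitary h
  have h1 : LinearMap.det ((Matrix.mulVecLin (U : Matrix ι ι ℂ)).restrictScalars ℝ) = 1 := by
    rw [LinearMap.det_restrictScalars, ← Matrix.toLin'_apply', LinearMap.det_toLin',
      Algebra.norm_complex_apply, Complex.normSq_eq_norm_sq, hdet, one_pow]
  refine ⟨(continuous_const.matrix_mulVec continuous_id).measurable, ?_⟩
  have h2 := Measure.map_linearMap_addHaar_eq_smul_addHaar (volume : Measure (ι → ℂ))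
    (f := (Matrix.mulVecLin (U : Matrix ι ι ℂ)).restrictScalars ℝ) (by rw [h1]; exact one_ne_zero)
  rw [h1, inv_one, abs_one, ENNReal.ofReal_one, one_smul] at h2
  exact h2

lemma lintegral_exp_neg_sum_mul_sq {c : ι → ℝ} (hc : ∀ i, 0 < c i) :
    ∫⁻ v : ι → ℂ, ENNReal.ofReal (Real.exp (-∑ i, c i * ‖v i‖ ^ 2)) =
      ENNReal.ofReal (∏ i, Real.pi / c i) := by
  have h1 : ∀ i, ∫ z : ℂ, Real.exp (-c i * ‖z‖ ^ 2) = Real.pi / c i := by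
    intro i
    rw [GaussianFourier.integral_rexp_neg_mul_sq_norm (hc i)]
    simp
  have hi : ∀ i, Integrable fun z : ℂ => Real.exp (-c i * ‖z‖ ^ 2) := by
    intro i
    by_contra h
    have := h1 i
    rw [integral_undef h] at this
    exact (div_pos Real.pi_pos (hc i)).ne this
  have e : ∀ v : ι → ℂ, Real.exp (-∑ i, c i * ‖v i‖ ^ 2) =
      ∏ i, Real.exp (-c i * ‖v i‖ ^ 2) := by
    intro v
    rw [← Real.exp_sum, ← Finset.sum_neg_distrib]
    simp only [neg_mul]
  simp_rw [e]
  have hip : Integrable (fun v : ι → ℂ => ∏ i, Real.exp (-c i * ‖v i‖ ^ 2)) :=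
    Integrable.fintype_prod hi
  rw [← ofReal_integral_eq_lintegral_ofReal hip
    (Filter.Eventually.of_forall fun v => Finset.prod_nonneg fun i _ => (Real.exp_pos _).le),
    integral_fintype_prod_volume_eq_prod fun i (z : ℂ) => Real.exp (-c i * ‖z‖ ^ 2)]
  simp_rw [h1]

lemma lintegral_exp_neg_mul_sqNorm {c : ℝ} (hc : 0 < c) :
    ∫⁻ v : ι → ℂ, ENNReal.ofReal (Real.exp (-(c * sqNorm v))) =
      ENNReal.ofReal ((Real.pi / c) ^ Fintype.card ι) := by
  have := lintegral_exp_neg_sum_mul_sq (ι := ι) (c := fun _ => c) fun _ => hc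
  simpa only [sqNorm, Finset.mul_sum, Finset.prod_const, Finset.card_univ] using this

/-- The Gaussian integral `∫ e^{λ⟨v|X|v⟩ - |v|²} dv = π^d / det(1 - λ X)`. -/
lemma lintegral_exp_quadForm_sub_sqNorm [DecidableEq ι] {X : Matrix ι ι ℂ} (hX : X.IsHermitian)
    {l : ℝ} (hl : ∀ i, l * hX.eigenvalues i < 1) :
    ∫⁻ v : ι → ℂ, ENNReal.ofReal (Real.exp (l * quadForm X v - sqNorm v)) =
      ENNReal.ofReal (∏ i, Real.pi / (1 - l * hX.eigenvalues i)) := by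
  have hm : Measurable fun v : ι → ℂ =>
      ENNReal.ofReal (Real.exp (l * quadForm X v - sqNorm v)) := by
    have h1 := (continuous_quadForm X).measurable
    have h2 := (continuous_sqNorm (ι := ι)).measurable
    fun_prop
  rw [← (measurePreserving_unitary_mulVec hX.eigenvectorUnitary).lintegral_comp hm,
    ← lintegral_exp_neg_sum_mul_sq fun i => sub_pos.2 (hl i)]
  refine lintegral_congr fun v => ?_
  rw [quadForm_eigenvectorUnitary_mulVec, sqNorm_unitary_mulVec, sqNorm, Finset.mul_sum,
    ← Finset.sum_sub_distrib, ← Finset.sum_neg_distrib]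
  congr 3
  ext i
  ring

end Gaussian

section Haar

variable {n : ℕ}

/-- Haar measure on the compact group `U(2^n)` is right invariant: its right translates are
left-invariant probability measures, hence equal to it. -/
lemma lintegral_haarUnitary_mul_right (W : UGroup n) (F : UGroup n → ENNReal) (hF : Measurable F) :
    ∫⁻ U, F (U * W) ∂haarUnitary n = ∫⁻ U, F U ∂haarUnitary n := by
  have hm : Measurable fun U : UGroup n => U * W := (continuous_mul_const W).measurable
  have : IsProbabilityMeasure ((haarUnitary n).map fun U => U * W) :=
    Measure.isProbabilityMeasure_map hm.aemeasurable
  have : (haarUnitary n).IsHaarMeasure := by unfold haarUnitary; infer_instance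
  have h : (haarUnitary n).map (fun U => U * W) = haarUnitary n := by
    have h1 := Measure.isMulInvariant_eq_smul_of_compactSpace
      ((haarUnitary n).map fun U => U * W) (haarUnitary n)
    have h2 := congrArg (fun ν : Measure (UGroup n) => ν Set.univ) h1
    simp only [measure_univ, Measure.smul_apply] at h2
    rw [h1]
    ext s _
    rw [Measure.smul_apply, ENNReal.smul_def]
    rw [ENNReal.smul_def] at h2
    simp only [smul_eq_mul, mul_one] at h2 ⊢
    rw [← h2, one_mul]
  conv_rhs => rw [← h]
  rw [lintegral_map hF hm]

/-- The unitary group acts transitively on vectors of a given norm. -/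
lemma exists_unitary_mulVec_ket (v : Bits n → ℂ) :
    ∃ W : UGroup n, v = ((Real.sqrt (sqNorm v) : ℝ) : ℂ) •
      ((W : Matrix (Bits n) (Bits n) ℂ) *ᵥ (Pi.single (fun _ => false) 1)) := by
  set z : Bits n := fun _ => false
  by_cases hv : sqNorm v = 0
  · refine ⟨1, ?_⟩
    rw [hv, Real.sqrt_zero, Complex.ofReal_zero, zero_smul]
    have h := (Finset.sum_eq_zero_iff_of_nonneg fun i _ => sq_nonneg ‖v i‖).1 hv
    ext i
    simpa using h i (Finset.mem_univ i)
  · set r := Real.sqrt (sqNorm v) with hr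
    have hr0 : r ≠ 0 := (Real.sqrt_ne_zero (sqNorm_nonneg v)).2 hv
    set u : EuclideanSpace ℂ (Bits n) := WithLp.toLp 2 (((r⁻¹ : ℝ) : ℂ) • v) with hu
    have hu1 : ‖u‖ = 1 := by
      have h : ‖u‖ ^ 2 = 1 := by
        rw [← sqNorm_eq_norm_sq, hu, sqNorm_smul, inv_pow, hr, Real.sq_sqrt (sqNorm_nonneg v),
          inv_mul_cancel₀ hv]
      exact (pow_eq_one_iff_of_nonneg (norm_nonneg u) two_ne_zero).1 h
    have ho : Orthonormal ℂ (({z} : Set (Bits n)).domRestrict fun _ => u) := by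
      refine ⟨fun _ => hu1, fun i j hij => (hij (Subsingleton.elim i j)).elim⟩
    obtain ⟨b, hb⟩ := ho.exists_orthonormalBasis_extension_of_card_eq
      (by simp) (v := fun _ : Bits n => u)
    have hW := (EuclideanSpace.basisFun (Bits n) ℂ).toMatrix_orthonormalBasis_mem_unitary b
    refine ⟨⟨_, hW⟩, ?_⟩
    have hcol : ((EuclideanSpace.basisFun (Bits n) ℂ).toBasis.toMatrix b) *ᵥ (Pi.single z 1) =
        u.ofLp := by
      rw [mulVec_single_one]
      ext i
      simp [Module.Basis.toMatrix_apply, hb z rfl]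
    simp only
    rw [hcol, hu, smul_smul, ← Complex.ofReal_mul, mul_inv_cancel₀ hr0, Complex.ofReal_one,
      one_smul]

/-- A Haar-random rotation of a fixed vector is a Haar state scaled by the norm of the vector. -/
lemma lintegral_haarUnitary_mulVec (F : (Bits n → ℂ) → ENNReal) (hF : Measurable F)
    (v : Bits n → ℂ) :
    ∫⁻ U : UGroup n, F ((U : Matrix (Bits n) (Bits n) ℂ) *ᵥ v) ∂haarUnitary n =
      ∫⁻ ψ, F (((Real.sqrt (sqNorm v) : ℝ) : ℂ) • (ψ : EuclideanSpace ℂ (Bits n)).ofLp)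
        ∂haarState n := by
  obtain ⟨W, hW⟩ := exists_unitary_mulVec_ket v
  set r := Real.sqrt (sqNorm v)
  have hket : Measurable fun U : UGroup n => applyU U (ket fun _ => false) :=
    (continuous_applyU.comp (continuous_id.prodMk continuous_const)).measurable
  have hc : Continuous fun ψ : QState n =>
      ((r : ℝ) : ℂ) • (ψ : EuclideanSpace ℂ (Bits n)).ofLp :=
    ((PiLp.continuous_ofLp 2 _).comp continuous_subtype_val).const_smul (r : ℂ)
  have hG : Measurable fun ψ : QState n => F (((r : ℝ) : ℂ) •
      (ψ : EuclideanSpace ℂ (Bits n)).ofLp) := hF.comp hc.measurable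
  rw [haarState, lintegral_map hG hket,
    ← lintegral_haarUnitary_mul_right W (fun U => F (((r : ℝ) : ℂ) •
      (applyU U (ket fun _ => false) : EuclideanSpace ℂ (Bits n)).ofLp)) (hG.comp hket)]
  refine lintegral_congr fun U => ?_
  conv_lhs => rw [hW]
  rw [mulVec_smul, mulVec_mulVec]
  rfl

end Haar

/-! ### Moment generating functions of Haar states, and the matrices `M(g; 𝒰)` -/

section Haar

variable {n : ℕ}

lemma sqNorm_qState (ψ : QState n) : sqNorm (ψ : EuclideanSpace ℂ (Bits n)).ofLp = 1 := by
  rw [sqNorm_eq_norm_sq, mem_sphere_zero_iff_norm.1 ψ.2, one_pow]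

lemma continuous_quadForm_qState (X : Matrix (Bits n) (Bits n) ℂ) :
    Continuous fun ψ : QState n => quadForm X (ψ : EuclideanSpace ℂ (Bits n)).ofLp :=
  (continuous_quadForm X).comp ((PiLp.continuous_ofLp 2 _).comp continuous_subtype_val)

/-- Averaging an integral over `ℂ^d` over all unitary rotations of the integrand replaces the
direction of the vector by a Haar state and keeps its norm. -/
lemma lintegral_eq_lintegral_haarState (F : (Bits n → ℂ) → ENNReal) (hF : Continuous F) :
    ∫⁻ v, F v = ∫⁻ ψ : QState n, (∫⁻ v : Bits n → ℂ,
      F (((Real.sqrt (sqNorm v) : ℝ) : ℂ) • (ψ : EuclideanSpace ℂ (Bits n)).ofLp))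
        ∂haarState n := by
  have hm1 : Measurable (Function.uncurry fun (U : UGroup n) (v : Bits n → ℂ) =>
      F ((U : Matrix (Bits n) (Bits n) ℂ) *ᵥ v)) := by
    have hc : Continuous fun p : UGroup n × (Bits n → ℂ) =>
        (p.1 : Matrix (Bits n) (Bits n) ℂ) *ᵥ p.2 :=
      (continuous_subtype_val.comp continuous_fst).matrix_mulVec continuous_snd
    exact hF.measurable.comp hc.measurable
  have hm2 : Measurable (Function.uncurry fun (v : Bits n → ℂ) (ψ : QState n) =>
      F (((Real.sqrt (sqNorm v) : ℝ) : ℂ) • (ψ : EuclideanSpace ℂ (Bits n)).ofLp)) := by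
    have hc1 : Continuous fun p : (Bits n → ℂ) × QState n => ((Real.sqrt (sqNorm p.1) : ℝ) : ℂ) :=
      Complex.continuous_ofReal.comp
        (Real.continuous_sqrt.comp (continuous_sqNorm.comp continuous_fst))
    have hc2 : Continuous fun p : (Bits n → ℂ) × QState n =>
        (p.2 : EuclideanSpace ℂ (Bits n)).ofLp :=
      (PiLp.continuous_ofLp 2 _).comp (continuous_subtype_val.comp continuous_snd)
    exact hF.measurable.comp (hc1.smul hc2).measurable
  calc ∫⁻ v, F v = ∫⁻ _U : UGroup n, (∫⁻ v, F v) ∂haarUnitary n := by simp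
    _ = ∫⁻ U : UGroup n, (∫⁻ v, F ((U : Matrix (Bits n) (Bits n) ℂ) *ᵥ v)) ∂haarUnitary n :=
        lintegral_congr fun U =>
          ((measurePreserving_unitary_mulVec U).lintegral_comp hF.measurable).symm
    _ = ∫⁻ v, ∫⁻ U : UGroup n, F ((U : Matrix (Bits n) (Bits n) ℂ) *ᵥ v) ∂haarUnitary n :=
        lintegral_lintegral_swap hm1.aemeasurable
    _ = ∫⁻ v, ∫⁻ ψ : QState n,
          F (((Real.sqrt (sqNorm v) : ℝ) : ℂ) • (ψ : EuclideanSpace ℂ (Bits n)).ofLp)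
          ∂haarState n :=
        lintegral_congr fun v => lintegral_haarUnitary_mulVec F hF.measurable v
    _ = _ := lintegral_lintegral_swap hm2.aemeasurable

/-- Averaging a Gaussian integral over the unitary group splits it into a radial Gaussian and a
Haar state. The radial part `(1 - λ q)^{-d}` dominates `e^{λ d q}`, so the moment generating
function of `d ⟨ψ|X|ψ⟩` is at most `det(1 - λ X)⁻¹`. -/
lemma lintegral_exp_quadForm_haarState_le {X : Matrix (Bits n) (Bits n) ℂ} (hX : X.IsHermitian)
    {l b : ℝ} (hl : 0 ≤ l) (hb : ∀ i, hX.eigenvalues i ≤ b) (hlb : l * b < 1) :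
    ∫⁻ ψ : QState n, ENNReal.ofReal
        (Real.exp (l * (2 ^ n * quadForm X (ψ : EuclideanSpace ℂ (Bits n)).ofLp)))
        ∂haarState n ≤
      ENNReal.ofReal (∏ i, (1 - l * hX.eigenvalues i)⁻¹) := by
  set F : (Bits n → ℂ) → ENNReal :=
    fun v => ENNReal.ofReal (Real.exp (l * quadForm X v - sqNorm v)) with hF
  have hFc : Continuous F := by
    have h1 := continuous_quadForm X
    have h2 := continuous_sqNorm (ι := Bits n)
    exact ENNReal.continuous_ofReal.comp (by fun_prop)
  have hcard : Fintype.card (Bits n) = 2 ^ n := by simp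
  have heig : ∀ i, l * hX.eigenvalues i < 1 := fun i =>
    (mul_le_mul_of_nonneg_left (hb i) hl).trans_lt hlb
  have hpi : (0 : ℝ) < Real.pi ^ (2 ^ n) := pow_pos Real.pi_pos _
  have hq : ∀ ψ : QState n, l * quadForm X (ψ : EuclideanSpace ℂ (Bits n)).ofLp < 1 := by
    intro ψ
    have h := quadForm_le_of_eigenvalues_le hX hb (ψ : EuclideanSpace ℂ (Bits n)).ofLp
    rw [sqNorm_qState, mul_one] at h
    exact (mul_le_mul_of_nonneg_left h hl).trans_lt hlb
  have h1 := lintegral_eq_lintegral_haarState F hFc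
  -- the radial integral for a fixed state
  have h2 : ∀ ψ : QState n, ∫⁻ v : Bits n → ℂ,
      F (((Real.sqrt (sqNorm v) : ℝ) : ℂ) • (ψ : EuclideanSpace ℂ (Bits n)).ofLp) =
      ENNReal.ofReal ((Real.pi /
        (1 - l * quadForm X (ψ : EuclideanSpace ℂ (Bits n)).ofLp)) ^ (2 ^ n)) := by
    intro ψ
    rw [← hcard, ← lintegral_exp_neg_mul_sqNorm (sub_pos.2 (hq ψ))]
    refine lintegral_congr fun v => ?_
    simp only [hF]
    rw [quadForm_smul, sqNorm_smul, Real.sq_sqrt (sqNorm_nonneg v), sqNorm_qState]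
    congr 2
    ring
  have h3 : ∀ ψ : QState n, ENNReal.ofReal (Real.pi ^ (2 ^ n)) * ENNReal.ofReal
      (Real.exp (l * (2 ^ n * quadForm X (ψ : EuclideanSpace ℂ (Bits n)).ofLp))) ≤
      ENNReal.ofReal ((Real.pi /
        (1 - l * quadForm X (ψ : EuclideanSpace ℂ (Bits n)).ofLp)) ^ (2 ^ n)) := by
    intro ψ
    set q := quadForm X (ψ : EuclideanSpace ℂ (Bits n)).ofLp
    have hpos : 0 < 1 - l * q := sub_pos.2 (hq ψ)
    rw [← ENNReal.ofReal_mul hpi.le, div_eq_mul_inv, mul_pow]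
    refine ENNReal.ofReal_le_ofReal (mul_le_mul_of_nonneg_left ?_ hpi.le)
    have he : Real.exp (l * q) ≤ (1 - l * q)⁻¹ := by
      rw [le_inv_comm₀ (Real.exp_pos _) hpos, ← Real.exp_neg]
      linarith [Real.add_one_le_exp (-(l * q))]
    have : Real.exp (l * (2 ^ n * q)) = Real.exp (l * q) ^ (2 ^ n) := by
      rw [← Real.exp_nat_mul]
      congr 1
      push_cast
      ring
    rw [this]
    exact pow_le_pow_left₀ (Real.exp_pos _).le he _
  have hmain : ENNReal.ofReal (Real.pi ^ (2 ^ n)) * ∫⁻ ψ : QState n, ENNReal.ofReal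
        (Real.exp (l * (2 ^ n * quadForm X (ψ : EuclideanSpace ℂ (Bits n)).ofLp)))
        ∂haarState n ≤
      ENNReal.ofReal (Real.pi ^ (2 ^ n)) *
        ENNReal.ofReal (∏ i, (1 - l * hX.eigenvalues i)⁻¹) := by
    rw [← lintegral_const_mul' _ _ ENNReal.ofReal_ne_top, ← ENNReal.ofReal_mul hpi.le]
    refine (lintegral_mono h3).trans ?_
    rw [← lintegral_congr h2, ← h1, lintegral_exp_quadForm_sub_sqNorm hX heig]
    simp only [div_eq_mul_inv, Finset.prod_mul_distrib, Finset.prod_const, Finset.card_univ, hcard]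
    exact le_rfl
  rwa [ENNReal.mul_le_mul_iff_right (by simpa using hpi) ENNReal.ofReal_ne_top] at hmain

/-- Sub-gamma bound for a Haar state measured with a density matrix `X`, of purity at most `A²`
and norm at most `B`. -/
lemma integral_exp_quadForm_haarState_le {X : Matrix (Bits n) (Bits n) ℂ} (hX : X.IsHermitian)
    {a A B l : ℝ} (ha : 1 < a) (h0 : ∀ i, 0 ≤ hX.eigenvalues i)
    (hB : ∀ i, hX.eigenvalues i ≤ B) (htr : ∑ i, hX.eigenvalues i = 1)
    (hA : ∑ i, hX.eigenvalues i ^ 2 ≤ A ^ 2) (hl : 0 ≤ l) (hlB : l * B ≤ 1 / a) :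
    ∫ ψ : QState n, Real.exp
        (l * (2 ^ n * quadForm X (ψ : EuclideanSpace ℂ (Bits n)).ofLp - 1)) ∂haarState n ≤
      Real.exp (gam a * a ^ 2 * A ^ 2 * l ^ 2) := by
  have ha0 : 0 < a := by linarith
  have ha1 : 1 / a < 1 := (div_lt_one ha0).2 ha
  have h := lintegral_exp_quadForm_haarState_le hX hl hB (hlB.trans_lt ha1)
  have hprod : ∏ i, (1 - l * hX.eigenvalues i)⁻¹ ≤
      Real.exp (l + gam a * a ^ 2 * A ^ 2 * l ^ 2) := by
    have hstep : ∏ i, (1 - l * hX.eigenvalues i)⁻¹ ≤ ∏ i, Real.exp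
        (l * hX.eigenvalues i + gam a * a ^ 2 * (l * hX.eigenvalues i) ^ 2) := by
      refine Finset.prod_le_prod (fun i _ => ?_) fun i _ => ?_
      · have := (mul_le_mul_of_nonneg_left (hB i) hl).trans hlB
        exact inv_nonneg.2 (by linarith)
      · exact inv_one_sub_le_exp_gam ha (mul_nonneg hl (h0 i))
          ((mul_le_mul_of_nonneg_left (hB i) hl).trans hlB)
    refine hstep.trans ?_
    rw [← Real.exp_sum, Finset.sum_add_distrib, ← Finset.mul_sum, htr, mul_one, ← Finset.mul_sum]
    simp_rw [mul_pow]
    rw [← Finset.mul_sum]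
    have hg := gam_pos ha
    refine Real.exp_le_exp.2 (add_le_add le_rfl ?_)
    calc gam a * a ^ 2 * (l ^ 2 * ∑ i, hX.eigenvalues i ^ 2)
        ≤ gam a * a ^ 2 * (l ^ 2 * A ^ 2) := by gcongr
      _ = _ := by ring
  have hc : Continuous fun ψ : QState n =>
      Real.exp (l * (2 ^ n * quadForm X (ψ : EuclideanSpace ℂ (Bits n)).ofLp)) := by
    have := continuous_quadForm_qState X
    fun_prop
  have hreal : ∫ ψ : QState n, Real.exp
      (l * (2 ^ n * quadForm X (ψ : EuclideanSpace ℂ (Bits n)).ofLp)) ∂haarState n ≤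
      Real.exp (l + gam a * a ^ 2 * A ^ 2 * l ^ 2) := by
    rw [integral_eq_lintegral_of_nonneg_ae (Filter.Eventually.of_forall fun _ => (Real.exp_pos _).le)
      hc.measurable.aestronglyMeasurable]
    exact ENNReal.toReal_le_of_le_ofReal (Real.exp_pos _).le
      (h.trans (ENNReal.ofReal_le_ofReal hprod))
  have e : ∀ ψ : QState n,
      Real.exp (l * (2 ^ n * quadForm X (ψ : EuclideanSpace ℂ (Bits n)).ofLp - 1)) =
      Real.exp (-l) * Real.exp (l * (2 ^ n * quadForm X (ψ : EuclideanSpace ℂ (Bits n)).ofLp)) := by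
    intro ψ
    rw [← Real.exp_add]
    congr 1
    ring
  simp_rw [e]
  rw [integral_const_mul]
  refine (mul_le_mul_of_nonneg_left hreal (Real.exp_pos _).le).trans_eq ?_
  rw [← Real.exp_add]
  congr 1
  ring

end Haar

section Strategy

variable {n : ℕ} {𝒰 : Measure (UGroup n)} {g : UGroup n → Bits n}

lemma measurable_row (hg : Measurable g) (i : Bits n) :
    Measurable fun U : UGroup n => (U : Matrix (Bits n) (Bits n) ℂ) (g U) i := by
  have h : Measurable fun p : Bits n × UGroup n => (p.2 : Matrix (Bits n) (Bits n) ℂ) p.1 i := by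
    refine measurable_from_prod_countable_right fun z => ?_
    have h1 : Continuous fun U : UGroup n => (U : Matrix (Bits n) (Bits n) ℂ) z i :=
      continuous_subtype_val.matrix_elem z i
    exact h1.measurable
  exact h.comp (hg.prodMk measurable_id)

lemma M_apply (i j : Bits n) :
    M 𝒰 g i j = ∫ U : UGroup n, star ((U : Matrix (Bits n) (Bits n) ℂ) (g U) i) *
      (U : Matrix (Bits n) (Bits n) ℂ) (g U) j ∂𝒰 := by
  simp only [M, Matrix.of_apply]
  refine integral_congr_ae (Filter.Eventually.of_forall fun U => ?_)
  simp [Matrix.mul_apply, Matrix.single_apply, ite_and]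

lemma integrable_star_mul_row [IsProbabilityMeasure 𝒰] (hg : Measurable g) (i j : Bits n) :
    Integrable (fun U : UGroup n => star ((U : Matrix (Bits n) (Bits n) ℂ) (g U) i) *
      (U : Matrix (Bits n) (Bits n) ℂ) (g U) j) 𝒰 := by
  refine Integrable.of_bound 
    ((continuous_star.measurable.comp (measurable_row hg i)).mul
      (measurable_row hg j)).aestronglyMeasurable 1 (Filter.Eventually.of_forall fun U => ?_)
  rw [norm_mul, norm_star]
  exact mul_le_one₀ (entry_norm_bound_of_unitary U.2 _ _) (norm_nonneg _)
    (entry_norm_bound_of_unitary U.2 _ _)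

lemma isHermitian_M : (M 𝒰 g).IsHermitian := by
  ext i j
  rw [Matrix.conjTranspose_apply, M_apply, M_apply, RCLike.star_def, ← integral_conj]
  refine integral_congr_ae (Filter.Eventually.of_forall fun U => ?_)
  simp [mul_comm]

/-- `⟨v|M(g; 𝒰)|v⟩` is the mean weight of Bob's outcome `g(U)` on `U v`. -/
lemma quadForm_M [IsProbabilityMeasure 𝒰] (hg : Measurable g) (v : Bits n → ℂ) :
    quadForm (M 𝒰 g) v =
      ∫ U : UGroup n, ‖((U : Matrix (Bits n) (Bits n) ℂ) *ᵥ v) (g U)‖ ^ 2 ∂𝒰 := by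
  have h : ∀ U : UGroup n, ((‖((U : Matrix (Bits n) (Bits n) ℂ) *ᵥ v) (g U)‖ ^ 2 : ℝ) : ℂ) =
      ∑ i, ∑ j, star (v i) * (star ((U : Matrix (Bits n) (Bits n) ℂ) (g U) i) *
        (U : Matrix (Bits n) (Bits n) ℂ) (g U) j) * v j := by
    intro U
    push_cast
    rw [← Complex.conj_mul', mulVec, dotProduct, map_sum, Finset.sum_mul_sum]
    refine Finset.sum_congr rfl fun i _ => Finset.sum_congr rfl fun j _ => ?_
    simp only [map_mul, RCLike.star_def]
    ring
  have hc : ((∫ U : UGroup n, ‖((U : Matrix (Bits n) (Bits n) ℂ) *ᵥ v) (g U)‖ ^ 2 ∂𝒰 : ℝ) : ℂ) =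
      star v ⬝ᵥ M 𝒰 g *ᵥ v := by
    rw [← integral_complex_ofReal]
    simp_rw [h]
    have hint : ∀ i j, Integrable (fun U : UGroup n =>
        star (v i) * (star ((U : Matrix (Bits n) (Bits n) ℂ) (g U) i) *
          (U : Matrix (Bits n) (Bits n) ℂ) (g U) j) * v j) 𝒰 := fun i j =>
      ((integrable_star_mul_row hg i j).const_mul _).mul_const _
    rw [integral_finsetSum _ fun i _ => integrable_finsetSum _ fun j _ => hint i j]
    simp only [dotProduct, mulVec, Pi.star_apply, Finset.mul_sum]
    refine Finset.sum_congr rfl fun i _ => ?_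
    rw [integral_finsetSum _ fun j _ => hint i j]
    refine Finset.sum_congr rfl fun j _ => ?_
    rw [integral_mul_const, integral_const_mul, ← M_apply]
    ring
  rw [quadForm, ← hc, Complex.ofReal_re]

lemma trace_M [IsProbabilityMeasure 𝒰] (hg : Measurable g) : (M 𝒰 g).trace = 1 := by
  simp only [Matrix.trace, Matrix.diag_apply, M_apply]
  rw [← integral_finsetSum _ fun i _ => integrable_star_mul_row hg i i]
  have : ∀ U : UGroup n, ∑ i, star ((U : Matrix (Bits n) (Bits n) ℂ) (g U) i) *
      (U : Matrix (Bits n) (Bits n) ℂ) (g U) i = 1 := by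
    intro U
    have h := congrFun (congrFun (Matrix.mem_unitaryGroup_iff.1 U.2) (g U)) (g U)
    rw [Matrix.mul_apply] at h
    simpa [mul_comm] using h
  simp_rw [this]
  simp

lemma eigenvalues_M_nonneg [IsProbabilityMeasure 𝒰] (hg : Measurable g) (i : Bits n) :
    0 ≤ (isHermitian_M (𝒰 := 𝒰) (g := g)).eigenvalues i := by
  rw [Matrix.IsHermitian.eigenvalues_eq]
  exact (integral_nonneg fun U => sq_nonneg _).trans_eq (quadForm_M hg _).symm

lemma sum_eigenvalues_M [IsProbabilityMeasure 𝒰] (hg : Measurable g) :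
    ∑ i, (isHermitian_M (𝒰 := 𝒰) (g := g)).eigenvalues i = 1 := by
  have h := (isHermitian_M (𝒰 := 𝒰) (g := g)).trace_eq_sum_eigenvalues
  rw [trace_M hg] at h
  exact Complex.ofReal_injective (by simpa using h.symm)

end Strategy

section Norms

variable {ι : Type} [Fintype ι] [DecidableEq ι] {X : Matrix ι ι ℂ}

lemma sum_eigenvalues_sq (hX : X.IsHermitian) :
    ∑ i, hX.eigenvalues i ^ 2 = frobNorm X ^ 2 := by
  have hV : (hX.eigenvectorUnitary : Matrix ι ι ℂ) * star (hX.eigenvectorUnitary : Matrix ι ι ℂ)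
      = 1 := Matrix.mem_unitaryGroup_iff.1 hX.eigenvectorUnitary.2
  have h := hX.conjStarAlgAut_star_eigenvectorUnitary
  rw [Unitary.conjStarAlgAut_star_apply] at h
  have htr : (Xᴴ * X).trace = ((∑ i, hX.eigenvalues i ^ 2 : ℝ) : ℂ) := by
    set V := (hX.eigenvectorUnitary : Matrix ι ι ℂ)
    have h1 : (Xᴴ * X).trace = ((star V * X * V) * (star V * X * V)).trace := by
      have : (star V * X * V) * (star V * X * V) = star V * (X * X * V) := by
        calc (star V * X * V) * (star V * X * V) = star V * X * (V * star V) * X * V := by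
              simp only [Matrix.mul_assoc]
          _ = _ := by rw [hV, Matrix.mul_one]; simp only [Matrix.mul_assoc]
      rw [this, Matrix.trace_mul_comm (star V), Matrix.mul_assoc (X * X), hV, Matrix.mul_one, hX.eq]
    rw [h1, h, Matrix.diagonal_mul_diagonal, Matrix.trace_diagonal]
    push_cast
    exact Finset.sum_congr rfl fun i _ => (sq _).symm
  have hnn : 0 ≤ ∑ i, hX.eigenvalues i ^ 2 := Finset.sum_nonneg fun i _ => sq_nonneg _
  rw [frobNorm, htr, Complex.ofReal_re, Real.sq_sqrt hnn]

lemma eigenvalues_le_opNorm (hX : X.IsHermitian) (i : ι) : hX.eigenvalues i ≤ opNorm X := by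
  have h := (Matrix.toEuclideanCLM (n := ι) (𝕜 := ℂ) X).le_opNorm (hX.eigenvectorBasis i)
  have h2 : Matrix.toEuclideanCLM (n := ι) (𝕜 := ℂ) X (hX.eigenvectorBasis i) =
      hX.eigenvalues i • hX.eigenvectorBasis i := by
    apply (WithLp.ofLp_injective 2)
    rw [Matrix.ofLp_toEuclideanCLM, hX.mulVec_eigenvectorBasis]
    rfl
  rw [h2, norm_smul, hX.eigenvectorBasis.orthonormal.1 i, mul_one, mul_one] at h
  exact (le_abs_self _).trans h

end Norms

/-! ### From protocols to maximal inequalities -/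

section Select

variable {S : Type*} [MeasurableSpace S] {μ : Measure S} [IsProbabilityMeasure μ]

lemma measurable_select {ι : Type*} [MeasurableSpace ι] [Countable ι] [MeasurableSingletonClass ι]
    {Y : ι → S → ℝ} {x : S → ι} (hY : ∀ i, Measurable (Y i)) (hx : Measurable x) :
    Measurable fun s => Y (x s) s := by
  have h : Measurable fun p : ι × S => Y p.1 p.2 := measurable_from_prod_countable_right hY
  exact h.comp (hx.prodMk measurable_id)

/-- The moment generating function of a variable selected from a finite family is at most the sum
of those of the family, whatever the selection rule. -/
lemma integral_exp_mul_select_le {ι : Type*} [Fintype ι] {Y : ι → S → ℝ} {K : ℝ} {x : S → ι}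
    (hY : ∀ i, Measurable (Y i)) (hK : ∀ i s, |Y i s| ≤ K) (hx : Measurable fun s => Y (x s) s)
    (l : ℝ) :
    ∫ s, Real.exp (l * Y (x s) s) ∂μ ≤ ∑ i, ∫ s, Real.exp (l * Y i s) ∂μ := by
  have hi : ∀ i, Integrable (fun s => Real.exp (l * Y i s)) μ := fun i =>
    integrable_exp_mul_of_abs_le (hY i) (hK i) l
  rw [← integral_finsetSum _ fun i _ => hi i]
  refine integral_mono (integrable_exp_mul_of_abs_le hx (fun s => hK _ s) l)
    (integrable_finsetSum _ fun i _ => hi i) fun s => ?_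
  exact Finset.single_le_sum (f := fun i => Real.exp (l * Y i s))
    (fun i _ => (Real.exp_pos _).le) (Finset.mem_univ (x s))

lemma integral_prod_prod_of_abs_le {T R : Type*} [MeasurableSpace T] [MeasurableSpace R]
    {ν : Measure T} {ρ : Measure R} [IsProbabilityMeasure ν] [IsProbabilityMeasure ρ]
    {f : S × T × R → ℝ} {K : ℝ} (hf : Measurable f) (hK : ∀ p, |f p| ≤ K) :
    ∫ p, f p ∂(μ.prod (ν.prod ρ)) = ∫ s, ∫ t, ∫ r, f (s, t, r) ∂ρ ∂ν ∂μ := by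
  rw [integral_prod _ (integrable_of_abs_le hf hK)]
  refine integral_congr_ae (Filter.Eventually.of_forall fun s => ?_)
  exact integral_prod _ (integrable_of_abs_le (hf.comp measurable_prodMk_left) fun q => hK (s, q))

end Select

section Protocol

variable {n m : ℕ} {𝒰 : Measure (UGroup n)} {A B : ℝ}

lemma NormBounds.eigenvalues_le (h : NormBounds 𝒰 A B) {g : UGroup n → Bits n}
    (hg : Measurable g) (i : Bits n) : (isHermitian_M (𝒰 := 𝒰) (g := g)).eigenvalues i ≤ B :=
  (eigenvalues_le_opNorm _ i).trans (h g hg).2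

lemma NormBounds.sum_eigenvalues_sq_le (h : NormBounds 𝒰 A B) {g : UGroup n → Bits n}
    (hg : Measurable g) :
    ∑ i, (isHermitian_M (𝒰 := 𝒰) (g := g)).eigenvalues i ^ 2 ≤ A ^ 2 := by
  rw [sum_eigenvalues_sq]
  exact pow_le_pow_left₀ (Real.sqrt_nonneg _) (h g hg).1 2

/-- `A` and `B` are positive, because `M(g; 𝒰)` has trace one. -/
lemma NormBounds.pos [IsProbabilityMeasure 𝒰] (h : NormBounds 𝒰 A B) : 0 < A ∧ 0 < B := by
  set g : UGroup n → Bits n := fun _ _ => false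
  have hg : Measurable g := measurable_const
  obtain ⟨i, -, hi⟩ : ∃ i ∈ Finset.univ, 0 < (isHermitian_M (𝒰 := 𝒰) (g := g)).eigenvalues i := by
    refine Finset.exists_lt_of_sum_lt ?_
    simp [sum_eigenvalues_M (𝒰 := 𝒰) hg]
  refine ⟨?_, hi.trans_le (h.eigenvalues_le hg i)⟩
  have hA : 0 ≤ A := (Real.sqrt_nonneg _).trans (h g hg).1
  have h2 : (isHermitian_M (𝒰 := 𝒰) (g := g)).eigenvalues i ^ 2 ≤ A ^ 2 :=
    (Finset.single_le_sum (f := fun i => (isHermitian_M (𝒰 := 𝒰) (g := g)).eigenvalues i ^ 2)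
      (fun j _ => sq_nonneg _) (Finset.mem_univ i)).trans (h.sum_eigenvalues_sq_le hg)
  exact hi.trans_le (abs_le_of_sq_le_sq' h2 hA).2

lemma norm_qState_apply_le (ψ : QState n) (z : Bits n) :
    ‖(ψ : EuclideanSpace ℂ (Bits n)) z‖ ≤ 1 := by
  have h := PiLp.norm_apply_le (ψ : EuclideanSpace ℂ (Bits n)) z
  rwa [mem_sphere_zero_iff_norm.1 ψ.2] at h

lemma ClassicalProtocol.measurable_output {Ω : Type u} [MeasurableSpace Ω]
    (P : ClassicalProtocol n m Ω) :
    Measurable fun p : Ω × QState n × UGroup n => P.output p.1 p.2.1 p.2.2 := by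
  have h : Measurable fun p : Bits m × Ω × UGroup n => P.bob p.1 p.2.1 p.2.2 :=
    measurable_from_prod_countable_right fun x => P.measurable_bob x
  have h1 : Measurable fun p : Ω × QState n × UGroup n => P.alice p.1 p.2.1 :=
    P.measurable_alice.comp (measurable_fst.prodMk (measurable_fst.comp measurable_snd))
  exact h.comp (h1.prodMk (measurable_fst.prodMk (measurable_snd.comp measurable_snd)))

lemma ClassicalProtocol.measurable_weight {Ω : Type u} [MeasurableSpace Ω]
    (P : ClassicalProtocol n m Ω) :
    Measurable fun p : Ω × QState n × UGroup n =>
      ‖(applyU p.2.2 p.2.1 : EuclideanSpace ℂ (Bits n)) (P.output p.1 p.2.1 p.2.2)‖ ^ 2 := by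
  have h : Measurable fun p : Bits n × QState n × UGroup n =>
      ‖(applyU p.2.2 p.2.1 : EuclideanSpace ℂ (Bits n)) p.1‖ ^ 2 := by
    refine measurable_from_prod_countable_right fun z => ?_
    have hc : Continuous fun q : QState n × UGroup n =>
        (applyU q.2 q.1 : EuclideanSpace ℂ (Bits n)) z :=
      (PiLp.continuous_apply 2 _ z).comp
        (continuous_subtype_val.comp (continuous_applyU.comp continuous_swap))
    exact (hc.norm.pow 2).measurable
  have hcomp := h.comp (P.measurable_output.prodMk measurable_snd)
  exact hcomp

/-- The score is an average over the seed of scores of deterministic protocols, each of which is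
the mean of `⟨ψ|M(g)|ψ⟩` for the strategy `g` selected by Alice's message on `ψ`. -/
lemma ClassicalProtocol.score_eq {Ω : Type u} [MeasurableSpace Ω] (P : ClassicalProtocol n m Ω)
    [IsProbabilityMeasure 𝒰] (𝒮 : Measure (QState n)) [IsProbabilityMeasure 𝒮] :
    P.score 𝒮 𝒰 = ∫ ω, ∫ ψ, quadForm (M 𝒰 (P.bob (P.alice ω ψ) ω))
      (ψ : EuclideanSpace ℂ (Bits n)).ofLp ∂𝒮 ∂P.rand := by
  have := P.isProb
  rw [ClassicalProtocol.score, integral_prod_prod_of_abs_le P.measurable_weight (K := 1)]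
  · refine integral_congr_ae (Filter.Eventually.of_forall fun ω =>
      integral_congr_ae (Filter.Eventually.of_forall fun ψ => ?_))
    have hg : Measurable (P.bob (P.alice ω ψ) ω) :=
      (P.measurable_bob (P.alice ω ψ)).comp measurable_prodMk_left
    have h := quadForm_M (𝒰 := 𝒰) hg (ψ : EuclideanSpace ℂ (Bits n)).ofLp
    exact h.symm
  · intro p
    rw [abs_pow, abs_norm]
    exact pow_le_one₀ (norm_nonneg _) (norm_qState_apply_le _ _)

/-- Reduction of the communication problem to a maximal inequality: a bound on `∫ Z` valid for
every bounded `Z` with the moment generating function of a maximum of `2^m` sub-gamma variables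
bounds `ε`. -/
lemma le_of_forall_integral_le [IsProbabilityMeasure 𝒰] {ε E : ℝ} {Ω : Type u} [MeasurableSpace Ω]
    (P : ClassicalProtocol n m Ω) (hNB : NormBounds 𝒰 A B) (hP : P.Solves (haarState n) 𝒰 ε)
    {a : ℝ} (ha : 1 < a)
    (hE : ∀ (Z : QState n → ℝ) (K : ℝ), Measurable Z → (∀ ψ, |Z ψ| ≤ K) →
      (∀ l, 0 < l → l ≤ 1 / (a * B) → ∫ ψ, Real.exp (l * Z ψ) ∂haarState n ≤
        2 ^ m * Real.exp (gam a * a ^ 2 * A ^ 2 * l ^ 2)) →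
      ∫ ψ, Z ψ ∂haarState n ≤ E) : ε ≤ E := by
  have := P.isProb
  have hB := hNB.pos.2
  have ha0 : 0 < a := by linarith
  have hgm : ∀ (x : Bits m) (ω : Ω), Measurable (P.bob x ω) := fun x ω =>
    (P.measurable_bob x).comp measurable_prodMk_left
  set Y : Ω → Bits m → QState n → ℝ := fun ω x ψ =>
    2 ^ n * quadForm (M 𝒰 (P.bob x ω)) (ψ : EuclideanSpace ℂ (Bits n)).ofLp - 1 with hY
  have hYm : ∀ ω x, Measurable (Y ω x) := fun ω x =>
    ((continuous_quadForm_qState _).measurable.const_mul _).sub_const 1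
  have hq : ∀ ω x (ψ : QState n),
      0 ≤ quadForm (M 𝒰 (P.bob x ω)) (ψ : EuclideanSpace ℂ (Bits n)).ofLp ∧
      quadForm (M 𝒰 (P.bob x ω)) (ψ : EuclideanSpace ℂ (Bits n)).ofLp ≤ B := by
    intro ω x ψ
    constructor
    · rw [quadForm_M (hgm x ω)]
      exact integral_nonneg fun U => sq_nonneg _
    · have h := quadForm_le_of_eigenvalues_le (isHermitian_M (𝒰 := 𝒰) (g := P.bob x ω))
        (hNB.eigenvalues_le (hgm x ω)) (ψ : EuclideanSpace ℂ (Bits n)).ofLp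
      rwa [sqNorm_qState, mul_one] at h
  have hYb : ∀ ω x ψ, |Y ω x ψ| ≤ 2 ^ n * B + 1 := by
    intro ω x ψ
    have h2 : (0 : ℝ) < 2 ^ n := by positivity
    have h3 := mul_nonneg h2.le (hq ω x ψ).1
    have h4 := mul_le_mul_of_nonneg_left (hq ω x ψ).2 h2.le
    rw [abs_le]
    simp only [hY]
    constructor <;> linarith
  have hZm : ∀ ω, Measurable fun ψ => Y ω (P.alice ω ψ) ψ := by
    intro ω
    have hal : Measurable (P.alice ω) := P.measurable_alice.comp measurable_prodMk_left
    exact measurable_select (hYm ω) hal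
  have hZ : ∀ ω, ∫ ψ, Y ω (P.alice ω ψ) ψ ∂haarState n ≤ E := by
    intro ω
    refine hE _ _ (hZm ω) (fun ψ => hYb ω _ ψ) fun l hl hlL => ?_
    have hlB : l * B ≤ 1 / a := by
      calc l * B ≤ 1 / (a * B) * B := by gcongr
        _ = 1 / a := by field_simp
    calc ∫ ψ, Real.exp (l * Y ω (P.alice ω ψ) ψ) ∂haarState n
        ≤ ∑ x, ∫ ψ, Real.exp (l * Y ω x ψ) ∂haarState n :=
          integral_exp_mul_select_le (hYm ω) (hYb ω) (hZm ω) l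
      _ ≤ ∑ _x : Bits m, Real.exp (gam a * a ^ 2 * A ^ 2 * l ^ 2) :=
          Finset.sum_le_sum fun x _ =>
            integral_exp_quadForm_haarState_le isHermitian_M ha (eigenvalues_M_nonneg (hgm x ω))
              (hNB.eigenvalues_le (hgm x ω)) (sum_eigenvalues_M (hgm x ω))
              (hNB.sum_eigenvalues_sq_le (hgm x ω)) hl.le hlB
      _ = 2 ^ m * Real.exp (gam a * a ^ 2 * A ^ 2 * l ^ 2) := by simp
  have h2 : (0 : ℝ) < 2 ^ n := by positivity
  have hscore : P.score (haarState n) 𝒰 ≤ (1 + E) / 2 ^ n := by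
    rw [P.score_eq]
    have hω : ∀ ω, ∫ ψ, quadForm (M 𝒰 (P.bob (P.alice ω ψ) ω))
        (ψ : EuclideanSpace ℂ (Bits n)).ofLp ∂haarState n ≤ (1 + E) / 2 ^ n := by
      intro ω
      have e : ∀ ψ : QState n, quadForm (M 𝒰 (P.bob (P.alice ω ψ) ω))
          (ψ : EuclideanSpace ℂ (Bits n)).ofLp = (Y ω (P.alice ω ψ) ψ + 1) / 2 ^ n := by
        intro ψ
        simp only [hY]
        field_simp
        ring
      simp_rw [e]
      rw [integral_div, integral_add (integrable_of_abs_le (hZm ω) fun ψ => hYb ω _ ψ)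
        (integrable_const _)]
      simp only [integral_const, probReal_univ, smul_eq_mul, mul_one]
      exact div_le_div_of_nonneg_right (by linarith [hZ ω]) h2.le
    have hnn : 0 ≤ (1 + E) / 2 ^ n := by
      obtain ⟨ω⟩ : Nonempty Ω := nonempty_of_isProbabilityMeasure P.rand
      exact (integral_nonneg fun ψ => (hq ω _ ψ).1).trans (hω ω)
    calc _ ≤ ∫ _ω : Ω, (1 + E) / 2 ^ n ∂P.rand :=
          integral_mono_of_nonneg (Filter.Eventually.of_forall fun ω =>
            integral_nonneg fun ψ => (hq ω _ ψ).1) (integrable_const _)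
            (Filter.Eventually.of_forall hω)
      _ = _ := by simp
  have h := (div_le_div_iff_of_pos_right h2).1 (le_trans hP hscore)
  linarith

end Protocol

section Bounds

variable {S : Type*} [MeasurableSpace S] {μ : Measure S} [IsProbabilityMeasure μ]
  {Z : S → ℝ} {K a A B : ℝ} {m : ℕ}

/-- The Chernoff bounds for `k = γ a² A²` and `L = 1 / (a B)`, where `t*` solves
`2^m · tail(t*) = 1`. -/
lemma integral_le_epsBound (ha : 1 < a) (hA : 0 < A) (hB : 0 < B) (hZ : Measurable Z)
    (hK : ∀ s, |Z s| ≤ K)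
    (hmgf : ∀ l, 0 < l → l ≤ 1 / (a * B) → ∫ s, Real.exp (l * Z s) ∂μ ≤
      2 ^ m * Real.exp (gam a * a ^ 2 * A ^ 2 * l ^ 2)) :
    ∫ s, Z s ∂μ ≤ epsBound a A B m := by
  have ha0 : 0 < a := by linarith
  have hg := gam_pos ha
  have hlog : 0 < Real.log 2 := Real.log_pos one_lt_two
  have hL : 0 < 1 / (a * B) := by positivity
  have hk : 0 < gam a * a ^ 2 * A ^ 2 := by positivity
  have hN : (0 : ℝ) ≤ 2 ^ m := by positivity
  have hsqrt : Real.sqrt (gam a * a ^ 2 * A ^ 2) = Real.sqrt (gam a) * a * A := by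
    rw [mul_assoc, ← mul_pow, Real.sqrt_mul hg.le, Real.sqrt_sq (by positivity), mul_assoc]
  have hkL : gam a * a ^ 2 * A ^ 2 * (1 / (a * B)) ^ 2 = gam a * A ^ 2 / B ^ 2 := by
    field_simp
  unfold epsBound tStar
  split_ifs with h
  · have h1 : Real.sqrt (Real.log 2 * m * (4 * gam a * a ^ 2 * A ^ 2)) ≤
        2 * (gam a * a ^ 2 * A ^ 2) * (1 / (a * B)) := by
      refine Real.sqrt_le_iff.2 ⟨by positivity, ?_⟩
      have h2 : Real.log 2 * m ≤ gam a * A ^ 2 / B ^ 2 := by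
        rw [le_div_iff₀ (by positivity)] at h ⊢
        linarith
      calc Real.log 2 * m * (4 * gam a * a ^ 2 * A ^ 2)
          ≤ gam a * A ^ 2 / B ^ 2 * (4 * gam a * a ^ 2 * A ^ 2) := by gcongr
        _ = _ := by
          field_simp
          norm_num
    have hmain := integral_le_add_gaussian_tail hZ hK hN hk hL hmgf (Real.sqrt_nonneg _) h1
    have e3 : Real.sqrt (Real.pi * (gam a * a ^ 2 * A ^ 2)) =
        Real.sqrt (Real.pi * gam a) * a * A := by
      rw [Real.sqrt_mul Real.pi_pos.le, hsqrt, Real.sqrt_mul Real.pi_pos.le]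
      ring
    rw [integral_gaussian_eq_erf hk, neg_mul, hkL, hsqrt, e3] at hmain
    refine hmain.trans_eq ?_
    have e1 : 2 * (gam a * a ^ 2 * A ^ 2) * (1 / (a * B)) / (2 * (Real.sqrt (gam a) * a * A)) =
        Real.sqrt (gam a) * A / B := by
      have hs := Real.sqrt_pos.2 hg
      nth_rewrite 1 [← Real.sq_sqrt hg.le]
      field_simp
    rw [e1]
    have e2 : 2 * (Real.sqrt (gam a) * a * A) = 2 * Real.sqrt (gam a) * a * A := by ring
    rw [e2]
    field_simp
  · have hmain := integral_le_add_exp_tail hZ hK hN hL hmgf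
      (a * B * (Real.log 2 * m + gam a * A ^ 2 / B ^ 2))
    have e1 : -(1 / (a * B)) * (a * B * (Real.log 2 * m + gam a * A ^ 2 / B ^ 2)) +
        gam a * a ^ 2 * A ^ 2 * (1 / (a * B)) ^ 2 = -(m * Real.log 2) := by
      rw [hkL]
      field_simp
      ring
    rw [e1, Real.exp_neg, Real.exp_nat_mul, Real.exp_log two_pos] at hmain
    refine hmain.trans_eq ?_
    field_simp

/-- The log-sum-exp bound at the parameter `a = 2`, with `l = min (√m / A) (1 / (2 B))`. -/
lemma integral_le_const_mul_max (hA : 0 < A) (hB : 0 < B) (hZ : Measurable Z)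
    (hK : ∀ s, |Z s| ≤ K)
    (hmgf : ∀ l, 0 < l → l ≤ 1 / (2 * B) → ∫ s, Real.exp (l * Z s) ∂μ ≤
      2 ^ m * Real.exp (gam 2 * 2 ^ 2 * A ^ 2 * l ^ 2)) :
    ∫ s, Z s ∂μ ≤ (2 + 4 * gam 2) * max (Real.sqrt m * A) (m * B) := by
  have hg := gam_pos (a := 2) one_lt_two
  have hL : 0 < 1 / (2 * B) := by positivity
  have hlog : Real.log 2 ≤ 1 := by linarith [Real.log_two_lt_d9]
  have key : ∀ l, 0 < l → l ≤ 1 / (2 * B) →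
      l * ∫ s, Z s ∂μ ≤ m + 4 * gam 2 * (A * l) ^ 2 := by
    intro l hl hlL
    have h := mul_integral_le_of_integral_exp_le (μ := μ) hZ hK
      (c := m * Real.log 2 + gam 2 * 2 ^ 2 * A ^ 2 * l ^ 2) ((hmgf l hl hlL).trans_eq (by
        rw [Real.exp_add, Real.exp_nat_mul, Real.exp_log two_pos]))
    have h2 : (m : ℝ) * Real.log 2 ≤ m := mul_le_of_le_one_right (Nat.cast_nonneg m) hlog
    linarith [show gam 2 * 2 ^ 2 * A ^ 2 * l ^ 2 = 4 * gam 2 * (A * l) ^ 2 by ring]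
  rcases Nat.eq_zero_or_pos m with rfl | hm
  · -- without communication the right-hand side vanishes; the parameter is sent to zero
    simp only [Nat.cast_zero, Real.sqrt_zero, zero_mul, max_self, mul_zero]
    by_contra! hI
    set I := ∫ s, Z s ∂μ
    set l := min (1 / (2 * B)) (I / (8 * gam 2 * A ^ 2)) with hl
    have hl0 : 0 < l := lt_min hL (by positivity)
    have h := key l hl0 (min_le_left _ _)
    have h3 : l * (8 * gam 2 * A ^ 2) ≤ I := by
      rw [← le_div_iff₀ (by positivity)]
      exact min_le_right _ _
    have h4 := mul_le_mul_of_nonneg_left h3 hl0.le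
    have h5 : 0 < l * I := mul_pos hl0 hI
    rw [Nat.cast_zero] at h
    linarith [show l * (l * (8 * gam 2 * A ^ 2)) = 2 * (4 * gam 2 * (A * l) ^ 2) by ring]
  · have hs : 0 < Real.sqrt m := Real.sqrt_pos.2 (by exact_mod_cast hm)
    have hss : Real.sqrt m * Real.sqrt m = m := Real.mul_self_sqrt (Nat.cast_nonneg m)
    set X := max (Real.sqrt m * A) (m * B)
    set l := min (Real.sqrt m / A) (1 / (2 * B)) with hl
    have hl0 : 0 < l := lt_min (by positivity) hL
    have h := key l hl0 (min_le_right _ _)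
    have hX1 : Real.sqrt m * A ≤ X := le_max_left _ _
    have hX2 : m * B ≤ X := le_max_right _ _
    have hlA : A * l ≤ Real.sqrt m := by
      rw [mul_comm, ← le_div_iff₀ hA]
      exact min_le_left _ _
    have h1 : (m : ℝ) ≤ l * (2 * X) := by
      rcases min_choice (Real.sqrt m / A) (1 / (2 * B)) with e | e
      · rw [hl, e]
        calc (m : ℝ) = Real.sqrt m / A * (Real.sqrt m * A) := by
              field_simp
              rw [sq, hss]
          _ ≤ Real.sqrt m / A * (2 * X) := by
              refine mul_le_mul_of_nonneg_left ?_ (by positivity)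
              linarith [mul_pos hs hA]
      · rw [hl, e]
        calc (m : ℝ) = 1 / (2 * B) * (2 * (m * B)) := by field_simp
          _ ≤ 1 / (2 * B) * (2 * X) := by gcongr
    have h2 : (A * l) ^ 2 ≤ l * X := by
      calc (A * l) ^ 2 = l * (A * l * A) := by ring
        _ ≤ l * (Real.sqrt m * A) := by gcongr
        _ ≤ l * X := by gcongr
    have h3 := mul_le_mul_of_nonneg_left h2 (show 0 ≤ 4 * gam 2 by positivity)
    refine le_of_mul_le_mul_left ?_ hl0
    calc _ ≤ m + 4 * gam 2 * (A * l) ^ 2 := h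
      _ ≤ l * (2 * X) + 4 * gam 2 * (l * X) := add_le_add h1 h3
      _ = l * ((2 + 4 * gam 2) * X) := by ring

/-- Inverting `ε ≤ C max(√m A, m B)` for `m`. -/
lemma min_mul_min_le_of_le_mul_max {C ε : ℝ} (hC : 0 < C) (hA : 0 < A) (hB : 0 < B)
    (h : ε ≤ C * max (Real.sqrt m * A) (m * B)) :
    min (1 / C ^ 2) (1 / C) * min (ε ^ 2 / A ^ 2) (ε / B) ≤ m := by
  have hc : 0 ≤ min (1 / C ^ 2) (1 / C) := le_min (by positivity) (by positivity)
  have hm : (0 : ℝ) ≤ m := Nat.cast_nonneg m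
  rcases le_or_gt ε 0 with hε | hε
  · refine le_trans (mul_nonpos_of_nonneg_of_nonpos hc ?_) hm
    exact (min_le_right _ _).trans (div_nonpos_of_nonpos_of_nonneg hε hB.le)
  · rw [mul_max_of_nonneg _ _ hC.le, le_max_iff] at h
    rcases h with h | h
    · have h2 : ε ^ 2 ≤ (C * (Real.sqrt m * A)) ^ 2 := pow_le_pow_left₀ hε.le h 2
      rw [mul_pow, mul_pow, Real.sq_sqrt hm] at h2
      calc _ ≤ 1 / C ^ 2 * (ε ^ 2 / A ^ 2) :=
            mul_le_mul (min_le_left _ _) (min_le_left _ _)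
              (le_min (by positivity) (by positivity)) (by positivity)
        _ = ε ^ 2 / (C ^ 2 * A ^ 2) := by field_simp
        _ ≤ m := by
            rw [div_le_iff₀ (by positivity)]
            linarith
    · calc _ ≤ 1 / C * (ε / B) :=
            mul_le_mul (min_le_right _ _) (min_le_right _ _)
              (le_min (by positivity) (by positivity)) (by positivity)
        _ = ε / (C * B) := by field_simp
        _ ≤ m := by
            rw [div_le_iff₀ (by positivity)]
            linarith

end Bounds

end DXHOG

end

theorem mainTheorem3 :
    -- the bound with explicit constants, for every value of the parameter `a > 1`
    (∀ (a : ℝ), 1 < a →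
      ∀ (n m : ℕ) (𝒰 : Measure (DXHOG.UGroup n)) [IsProbabilityMeasure 𝒰] (A B ε : ℝ)
        (Ω : Type u) [MeasurableSpace Ω] (P : DXHOG.ClassicalProtocol n m Ω),
        DXHOG.NormBounds 𝒰 A B → P.Solves (DXHOG.haarState n) 𝒰 ε →
          ε ≤ DXHOG.epsBound a A B m) ∧
    -- the asymptotic bound on `ε`, with a universal constant
    (∃ C : ℝ, 0 < C ∧
      ∀ (n m : ℕ) (𝒰 : Measure (DXHOG.UGroup n)) [IsProbabilityMeasure 𝒰] (A B ε : ℝ)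
        (Ω : Type u) [MeasurableSpace Ω] (P : DXHOG.ClassicalProtocol n m Ω),
        DXHOG.NormBounds 𝒰 A B → P.Solves (DXHOG.haarState n) 𝒰 ε →
          ε ≤ C * max (Real.sqrt m * A) (m * B)) ∧
    -- the lower bound on the communication, with a universal constant
    (∃ c : ℝ, 0 < c ∧
      ∀ (n m : ℕ) (𝒰 : Measure (DXHOG.UGroup n)) [IsProbabilityMeasure 𝒰] (A B ε : ℝ)
        (Ω : Type u) [MeasurableSpace Ω] (P : DXHOG.ClassicalProtocol n m Ω),
        DXHOG.NormBounds 𝒰 A B → P.Solves (DXHOG.haarState n) 𝒰 ε →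
          c * min (ε ^ 2 / A ^ 2) (ε / B) ≤ m) := by
  refine ⟨?_, ?_, ?_⟩
  · intro a ha n m 𝒰 _ A B ε Ω _ P hNB hP
    exact DXHOG.le_of_forall_integral_le P hNB hP ha fun Z K hZ hK hmgf =>
      DXHOG.integral_le_epsBound ha hNB.pos.1 hNB.pos.2 hZ hK hmgf
  · refine ⟨2 + 4 * DXHOG.gam 2, by linarith [DXHOG.gam_pos one_lt_two], ?_⟩
    intro n m 𝒰 _ A B ε Ω _ P hNB hP
    exact DXHOG.le_of_forall_integral_le P hNB hP one_lt_two fun Z K hZ hK hmgf =>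
      DXHOG.integral_le_const_mul_max hNB.pos.1 hNB.pos.2 hZ hK hmgf
  · have hC : 0 < 2 + 4 * DXHOG.gam 2 := by linarith [DXHOG.gam_pos one_lt_two]
    refine ⟨min (1 / (2 + 4 * DXHOG.gam 2) ^ 2) (1 / (2 + 4 * DXHOG.gam 2)),
      lt_min (by positivity) (by positivity), ?_⟩
    intro n m 𝒰 _ A B ε Ω _ P hNB hP
    exact DXHOG.min_mul_min_le_of_le_mul_max hC hNB.pos.1 hNB.pos.2
      (DXHOG.le_of_forall_integral_le P hNB hP one_lt_two fun Z K hZ hK hmgf =>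
        DXHOG.integral_le_const_mul_max hNB.pos.1 hNB.pos.2 hZ hK hmgf)
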